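/- Notation. For $F:\mathbb C\to\mathbb C$ put $F^\#(z):=\overline{F(\bar z)}$, and let $\mathbb C^+$ be the open upper half-plane. A *de Branges space* is a Hilbert space $\mathcal H\neq\{0\}$ of entire functions with continuous point evaluations such that $F\in\mathcal H$ implies $F^\#\in\mathcal H$ and $\|F^\#\|=\|F\|$, and such that, if $F\in\mathcal H$, $w\in\mathbb C\setminus\mathbb R$ and $F(w)=0$, then $\frac{z-\bar w}{z-w}F(z)\in\mathcal H$ and it has the same norm as $F$. $\mathrm{Sub}\,\mathcal H$ is the set of all linear subspaces of $\mathcal H$ which are themselves de Branges spaces with the inner product inherited from $\mathcal H$. An entire function $E$ is *Hermite–Biehler* if $|E^\#(z)|<|E(z)|$ for $z\in\mathbb C^+$; then $\mathcal H(E)$ is the space of all entire $F$ with $F/E,\ F^\#/E\in H^2(\mathbb C^+)$, with inner product $(F,G)_E=\int_{\mathbb R}F(t)\overline{G(t)}\,|E(t)|^{-2}\,dt$. Put $$\mathfrak m_E(z):=\frac{\max\{|E(z)|,|E^\#(z)|\}}{|z+i|},\qquad z\in\mathbb C^+\cup\mathbb R.$$ For $D\subseteq\mathbb C^+\cup\mathbb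 R$ and $\mathfrak m:D\to[0,\infty)$, let $\mathcal R_{\mathfrak m}(\mathcal H)$ be the closure in $\mathcal H$ of $$R_{\mathfrak m}(\mathcal H):=\{F\in\mathcal H:\ \exists\,C>0\ \ \forall z\in D:\ |F(z)|\le C\,\mathfrak m(z)\ \text{ and }\ |F^\#(z)|\le C\,\mathfrak m(z)\}.$$ Proposition. Let $\beta\in(0,\tfrac12]$ and $D=\mathbb R\cup e^{i\pi\beta}[0,\infty)$. Let $\mathcal H$ be a de Branges space, let $\mathcal L\in\mathrm{Sub}\,\mathcal H$, and let $E_1$ be a Hermite–Biehler function with $\mathcal L=\mathcal H(E_1)$ (equality of Hilbert spaces: same elements and same inner product). Then $\mathcal L=\mathcal R_{\mathfrak m_{E_1}|_D}(\mathcal H)$. -/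

import Mathlib

open scoped ComplexConjugate ENNReal NNReal

noncomputable section

/-- A linear subspace of a Hilbert space of functions, with the inherited inner product,
is again a space of functions with continuous point evaluations. -/
instance Submodule.instRKHSComplex {H : Type*} [NormedAddCommGroup H] [InnerProductSpace ℂ H]
    [RKHS ℂ H ℂ ℂ] (L : Submodule ℂ H) : RKHS ℂ L ℂ ℂ where
  coeCLM := (RKHS.coeCLM ℂ : H →L[ℂ] ℂ → ℂ).comp L.subtypeL
  coeCLM_injective := RKHS.coeCLM_injective.comp Subtype.val_injective

namespace DeBranges

/-- The function `F^#(z) = conj (F (conj z))`. -/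
def sharp (F : ℂ → ℂ) : ℂ → ℂ := fun z => conj (F (conj z))

/-- The axioms of a de Branges space: a nonzero Hilbert space of entire functions on which point
evaluations are continuous (this is part of the class `RKHS`), which is invariant and isometric
under `F ↦ F^#`, and under division of nonreal zeros. -/
structure IsDeBrangesSpace (H : Type*) [NormedAddCommGroup H] [InnerProductSpace ℂ H]
    [RKHS ℂ H ℂ ℂ] : Prop where
  complete : CompleteSpace H
  nontrivial : Nontrivial H
  entire : ∀ F : H, Differentiable ℂ (F : ℂ → ℂ)
  sharp_mem : ∀ F : H, ∃ G : H, (G : ℂ → ℂ) = sharp F ∧ ‖G‖ = ‖F‖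
  div_mem : ∀ (w : ℂ) (F : H), w.im ≠ 0 → F w = 0 →
    ∃ G : H, (∀ z : ℂ, z ≠ w → G z = (z - conj w) / (z - w) * F z) ∧ ‖G‖ = ‖F‖

/-- `Sub H`: the linear subspaces of `H` which, with the inner product inherited from `H`, are
themselves de Branges spaces. -/
def Sub (H : Type*) [NormedAddCommGroup H] [InnerProductSpace ℂ H] [RKHS ℂ H ℂ ℂ] :
    Set (Submodule ℂ H) :=
  {L | IsDeBrangesSpace L}

/-- The Hermite-Biehler class. -/
def HermiteBiehler : Set (ℂ → ℂ) :=
  {E | Differentiable ℂ E ∧ ∀ z : ℂ, 0 < z.im → ‖sharp E z‖ < ‖E z‖}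

/-- The Hardy space `H²` of the open upper half-plane. The values of the functions off the open
upper half-plane play no role. -/
def HardyTwo : Set (ℂ → ℂ) :=
  {f | DifferentiableOn ℂ f {z : ℂ | 0 < z.im} ∧
    ∃ C : ℝ≥0, ∀ y : ℝ, 0 < y →
      ∫⁻ x : ℝ, ‖f ((x : ℂ) + (y : ℂ) * Complex.I)‖ₑ ^ 2 ≤ (C : ℝ≥0∞)}

/-- The set of functions that underlies the space `H(E)`. -/
def spaceOf (E : ℂ → ℂ) : Set (ℂ → ℂ) :=
  {F | Differentiable ℂ F ∧ (fun z => F z / E z) ∈ HardyTwo ∧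
    (fun z => sharp F z / E z) ∈ HardyTwo}

/-- The inner product `(F, G)_E` of `H(E)`, linear in `F` and conjugate linear in `G`. -/
def innerOf (E F G : ℂ → ℂ) : ℂ :=
  ∫ t : ℝ, F t * conj (G t) / ((‖E t‖ ^ 2 : ℝ) : ℂ)

/-- `K = H(E)` as Hilbert spaces of functions, where `E` is a Hermite-Biehler function: the
elements of `K` are exactly the functions in `H(E)`, and the inner products agree. (In Mathlib
`inner ℂ G F` is linear in `F`.) -/
structure EqSpaceOf (K : Type*) [NormedAddCommGroup K] [InnerProductSpace ℂ K]
    [RKHS ℂ K ℂ ℂ] (E : ℂ → ℂ) : Prop where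
  hermiteBiehler : E ∈ HermiteBiehler
  range_eq : Set.range (fun F : K => (F : ℂ → ℂ)) = spaceOf E
  inner_eq : ∀ F G : K, inner ℂ G F = innerOf E F G

/-- `R_m(H)` for a majorant `m` defined on `D`. -/
def majorized (H : Type*) [NormedAddCommGroup H] [InnerProductSpace ℂ H] [RKHS ℂ H ℂ ℂ]
    {D : Set ℂ} (m : D → ℝ) : Set H :=
  {F | ∃ C : ℝ, 0 < C ∧ ∀ z : D, ‖F (z : ℂ)‖ ≤ C * m z ∧ ‖sharp F (z : ℂ)‖ ≤ C * m z}

/-- The closure of `R_m(H)` in `H`. -/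
def majorizedClosure (H : Type*) [NormedAddCommGroup H] [InnerProductSpace ℂ H] [RKHS ℂ H ℂ ℂ]
    {D : Set ℂ} (m : D → ℝ) : Set H :=
  closure (majorized H m)

/-- The majorant `m_E(z) = max (|E z|, |E^# z|) / |z + i|`. -/
def majorant (E : ℂ → ℂ) : ℂ → ℝ := fun z => max ‖E z‖ ‖sharp E z‖ / ‖z + Complex.I‖

/-- The set `ℝ ∪ e^{iπβ} [0, ∞)`. -/
def lineRay (β : ℝ) : Set ℂ :=
  Set.range (fun x : ℝ => (x : ℂ)) ∪
    (fun r : ℝ => Complex.exp (Complex.I * (Real.pi : ℂ) * (β : ℂ)) * (r : ℂ)) '' Set.Ici 0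

end DeBranges

end

/-! ### Lower bounds for zero-free functions -/

/-! Let `m` be the majorant of `E`, which equals |E(z)|/|z+i| on the closed upper half-plane, and
let K_w be the kernel function of H(E) at a point w with Im w > 0.

L lies in the closure: K_w and its reflection K_w^# are O(`m`) on the closed half-plane, so every
K_w is majorized. Their span is dense in L (`EqSpaceOf.dense_span_kernelFun`), because Cauchy's
theorem in H² shows that K_w is orthogonal to every element of L vanishing at w.

The closure lies in L: since L is complete, it suffices that a majorized F belongs to L. The
function G = K_i lies in L, has no zeros in the open half-plane, and |G| is comparable to `m`. Hence
F/G is bounded on the line and on the ray, and everything rests on a Phragmén-Lindelöf argument in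
the two sectors cut out by the ray. Both have opening less than π, so exponential type is enough
growth control.

That control comes from the ambient space. With k the reproducing kernel of H at i, every X in H
satisfies X/((z+i)k) = O((Im z)^(-1/2)) (`IsDeBrangesSpace.sq_norm_apply_le`). Apply this to F and
to G; as G/((z+i)k) has no zeros, Borel-Carathéodory bounds its reciprocal, so |F/G| ≤ exp(A|z|³/(Im
z)²). Boundedness on the real line removes the singularity at the line and leaves exponential type
(`exists_norm_le_exp_of_bounded_on_real`). The outcome is F = O(`m`) in the half-plane; the same
holds for F^#, and 1/|z+i| is uniformly square integrable on horizontal lines, so F lies in H(E) =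
L. -/

/-- A zero-free holomorphic function on the unit disc, bounded by `exp M`, admits a lower bound. -/
theorem norm_inv_le_exp_of_ne_zero_on_ball {V : ℂ → ℂ} {M : ℝ}
    (hV : DifferentiableOn ℂ V (Metric.ball 0 1)) (hV0 : ∀ ξ ∈ Metric.ball (0 : ℂ) 1, V ξ ≠ 0)
    (hM : ∀ ξ ∈ Metric.ball (0 : ℂ) 1, ‖V ξ‖ ≤ Real.exp M) {ξ : ℂ}
    (hξ : ξ ∈ Metric.ball (0 : ℂ) 1) :
    ‖V ξ‖⁻¹ ≤ Real.exp (-Real.log ‖V 0‖ + 2 * (M - Real.log ‖V 0‖ + 1) / (1 - ‖ξ‖)) := by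
  have hmem0 : (0 : ℂ) ∈ Metric.ball (0 : ℂ) 1 := Metric.mem_ball_self one_pos
  -- A primitive ℓ of V'/V with ℓ(0) = 0 is a logarithm of V/V(0).
  have hexact : Complex.IsExactOn (fun z => deriv V z / V z) (Metric.ball 0 1) :=
    ((hV.deriv Metric.isOpen_ball).div hV hV0).isExactOn_ball
  obtain ⟨ℓ, hℓ0, hℓ⟩ := hexact.with_val_at 0 0
  have hconst : ∀ z ∈ Metric.ball (0 : ℂ) 1, Complex.exp (-ℓ z) * V z = V 0 := by
    intro z hz
    have key : ∀ z ∈ Metric.ball (0 : ℂ) 1,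
        HasDerivAt (fun z => Complex.exp (-ℓ z) * V z) 0 z := by
      intro z hz
      have h1 := ((hℓ z hz).neg).cexp
      have h2 := (hV.differentiableAt (Metric.isOpen_ball.mem_nhds hz)).hasDerivAt
      refine (h1.mul h2).congr_deriv ?_
      have := hV0 z hz
      field_simp
      ring
    have := Metric.isOpen_ball.is_const_of_deriv_eq_zero
      (convex_ball (0 : ℂ) 1).isPreconnected
      (fun z hz => (key z hz).differentiableAt.differentiableWithinAt)
      (fun z hz => (key z hz).deriv) hz hmem0
    simpa [hℓ0] using this
  have hVexp : ∀ z ∈ Metric.ball (0 : ℂ) 1, V z = V 0 * Complex.exp (ℓ z) := by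
    intro z hz
    rw [← hconst z hz, mul_right_comm, ← Complex.exp_add]
    simp
  have hnorm : ∀ z ∈ Metric.ball (0 : ℂ) 1, ‖V z‖ = ‖V 0‖ * Real.exp (ℓ z).re := by
    intro z hz
    conv_lhs => rw [hVexp z hz]
    rw [norm_mul, Complex.norm_exp]
  have hpos : 0 < ‖V 0‖ := norm_pos_iff.2 (hV0 0 hmem0)
  have hlogle : Real.log ‖V 0‖ ≤ M := by
    rw [Real.log_le_iff_le_exp hpos]
    exact hM 0 hmem0
  -- The summand 1 makes the bound on Re ℓ strictly positive, as Borel-Carathéodory requires.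
  have hre : Set.MapsTo ℓ (Metric.ball 0 1) {z | z.re ≤ M - Real.log ‖V 0‖ + 1} := by
    intro z hz
    have h := hM z hz
    rw [hnorm z hz, ← Real.exp_log hpos, ← Real.exp_add, Real.exp_le_exp] at h
    show (ℓ z).re ≤ _
    linarith
  have hb := Complex.borelCaratheodory_zero (M := M - Real.log ‖V 0‖ + 1) (by linarith)
    (fun z hz => (hℓ z hz).differentiableAt.differentiableWithinAt) hre one_pos hξ hℓ0
  have hξ1 : ‖ξ‖ < 1 := by simpa using hξ
  have hb' : ‖ℓ ξ‖ ≤ 2 * (M - Real.log ‖V 0‖ + 1) / (1 - ‖ξ‖) := by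
    refine hb.trans ?_
    have : 0 < 1 - ‖ξ‖ := by linarith
    gcongr ?_ / _
    exact mul_le_of_le_one_right (by linarith) hξ1.le
  rw [hnorm ξ hξ, mul_inv, Real.exp_add, Real.exp_neg, Real.exp_log hpos, ← Real.exp_neg]
  gcongr
  exact (neg_le_abs _).trans ((Complex.abs_re_le_norm _).trans hb')

/-- A zero-free holomorphic function on the upper half-plane which is `O((Im z)^{-1/2})` admits a
lower bound of exponential type away from the real line. -/
theorem exists_norm_inv_le_exp_of_ne_zero {v : ℂ → ℂ} {c : ℝ}
    (hv : DifferentiableOn ℂ v {z : ℂ | 0 < z.im}) (hv0 : ∀ z : ℂ, 0 < z.im → v z ≠ 0)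
    (hc : ∀ z : ℂ, 0 < z.im → ‖v z‖ ≤ c / √z.im) :
    ∃ A : ℝ, 0 ≤ A ∧ ∀ z : ℂ, 0 < z.im → 1 ≤ ‖z‖ →
      ‖v z‖⁻¹ ≤ Real.exp (A * ‖z‖ ^ 3 / z.im ^ 2) := by
  set Q : ℝ := |Real.log ‖v Complex.I‖| + |Real.log c| + 2 with hQ
  have hQ2 : 2 ≤ Q := by
    have := abs_nonneg (Real.log ‖v Complex.I‖)
    have := abs_nonneg (Real.log c)
    linarith
  have hcpos : 0 < c := by
    have h1 := hc Complex.I (by simp)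
    have h2 := norm_pos_iff.2 (hv0 Complex.I (by simp))
    simp at h1
    linarith
  -- 65 = 64 + 1: the factors 2, 1/δ ≤ 2|z|/y and 1/(1-|ξ|) ≤ 16|z|²/y give 64, and -log|v(i)| ≤ Q
  -- is absorbed because |z|³/y² ≥ 1.
  refine ⟨65 * Q, by positivity, fun z hz hz1 => ?_⟩
  obtain ⟨y, hy⟩ : ∃ y, y = z.im := ⟨_, rfl⟩
  rw [← hy] at hz ⊢
  -- The half-plane Im > δ contains both z and i, and v is bounded on it by c/√δ.
  obtain ⟨δ, hδ⟩ : ∃ δ, δ = min y 1 / 2 := ⟨_, rfl⟩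
  have hyz : y ≤ ‖z‖ := by rw [hy]; exact (le_abs_self _).trans (Complex.abs_im_le_norm z)
  have hδ0 : 0 < δ := by rw [hδ]; positivity
  have hδ1 : δ ≤ 1 / 2 := by rw [hδ]; have := min_le_right y 1; linarith
  have hδy : δ ≤ y / 2 := by rw [hδ]; have := min_le_left y 1; linarith
  have hδinv : δ⁻¹ ≤ 2 * ‖z‖ / y := by
    rw [inv_le_comm₀ hδ0 (by positivity), hδ, inv_div, div_le_div_iff₀ (by positivity) two_pos]
    rcases le_total y 1 with h | h
    · rw [min_eq_left h]; nlinarith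
    · rw [min_eq_right h]; nlinarith
  have h1δ : 0 < 1 - δ := by linarith
  -- The Möbius map from the disc to Im > δ with φ(0) = i.
  let φ : ℂ → ℂ := fun ξ => Complex.I * (δ + (1 - δ : ℝ) * ((1 + ξ) / (1 - ξ)))
  have hden : ∀ ξ ∈ Metric.ball (0 : ℂ) 1, 1 - ξ ≠ 0 := by
    intro ξ hξ h
    have : ξ = 1 := by linear_combination -h
    rw [this] at hξ
    simp at hξ
  have hφim : ∀ ξ ∈ Metric.ball (0 : ℂ) 1, δ < (φ ξ).im := by
    intro ξ hξ
    have hn : 0 < Complex.normSq (1 - ξ) := Complex.normSq_pos.2 (hden ξ hξ)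
    have hξ1 : ‖ξ‖ ^ 2 < 1 := by
      have : ‖ξ‖ < 1 := by simpa using hξ
      nlinarith [norm_nonneg ξ]
    have hre : ((1 + ξ) / (1 - ξ)).re = (1 - ‖ξ‖ ^ 2) / Complex.normSq (1 - ξ) := by
      rw [Complex.div_re, Complex.sq_norm, Complex.normSq_apply ξ]
      simp
      ring
    have : (φ ξ).im = δ + (1 - δ) * ((1 + ξ) / (1 - ξ)).re := by
      simp [φ, Complex.mul_im]
    rw [this, hre]
    have : 0 < (1 - ‖ξ‖ ^ 2) / Complex.normSq (1 - ξ) := div_pos (by linarith) hn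
    nlinarith [mul_pos h1δ this]
  have hφd : DifferentiableOn ℂ φ (Metric.ball 0 1) := by
    intro ξ hξ
    have := hden ξ hξ
    apply DifferentiableAt.differentiableWithinAt
    simp only [φ]
    fun_prop (disch := assumption)
  let M : ℝ := Real.log c + δ⁻¹
  let V : ℂ → ℂ := v ∘ φ
  have hVd : DifferentiableOn ℂ V (Metric.ball 0 1) :=
    hv.comp hφd fun ξ hξ => hδ0.trans (hφim ξ hξ)
  have hVM : ∀ ξ ∈ Metric.ball (0 : ℂ) 1, ‖V ξ‖ ≤ Real.exp M := by
    intro ξ hξ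
    have h := hφim ξ hξ
    refine (hc _ (hδ0.trans h)).trans ?_
    rw [Real.exp_add, Real.exp_log hcpos, div_eq_mul_inv]
    gcongr
    calc (√(φ ξ).im)⁻¹ ≤ (√δ)⁻¹ := by gcongr
      _ ≤ δ⁻¹ := by
        gcongr
        exact Real.le_sqrt_of_sq_le (by nlinarith)
      _ ≤ Real.exp δ⁻¹ := by linarith [Real.add_one_le_exp δ⁻¹]
  have hV0 : ∀ ξ ∈ Metric.ball (0 : ℂ) 1, V ξ ≠ 0 := fun ξ hξ =>
    hv0 _ (hδ0.trans (hφim ξ hξ))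
  -- Inverting φ at z: w is the value that (1+ξ)/(1-ξ) must take.
  obtain ⟨w, hw⟩ : ∃ w : ℂ, w = (-Complex.I * z - δ) / (1 - δ : ℝ) := ⟨_, rfl⟩
  have hδc : ((1 - δ : ℝ) : ℂ) ≠ 0 := by exact_mod_cast h1δ.ne'
  have hwre : w.re = (y - δ) / (1 - δ) := by
    rw [hw, Complex.div_ofReal_re]
    simp [hy]
  have hwre' : y / 2 ≤ w.re := by
    rw [hwre, le_div_iff₀ h1δ]
    nlinarith
  have hw1 : w + 1 ≠ 0 := by
    intro h
    have := congrArg Complex.re h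
    simp at this
    linarith
  obtain ⟨ξ, hξdef⟩ : ∃ ξ : ℂ, ξ = (w - 1) / (w + 1) := ⟨_, rfl⟩
  have hsq : ‖w + 1‖ ^ 2 - ‖w - 1‖ ^ 2 = 4 * w.re := by
    rw [Complex.sq_norm, Complex.sq_norm, Complex.normSq_apply, Complex.normSq_apply]
    simp
    ring
  have hwp : 0 < ‖w + 1‖ := norm_pos_iff.2 hw1
  have hw4 : ‖w + 1‖ ≤ 4 * ‖z‖ := by
    have : w + 1 = (-Complex.I * z + (1 - 2 * δ : ℝ)) / (1 - δ : ℝ) := by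
      rw [hw]; field_simp; push_cast; ring
    rw [this, norm_div, Complex.norm_real, Real.norm_of_nonneg h1δ.le, div_le_iff₀ h1δ]
    have h1 : ‖-Complex.I * z + (1 - 2 * δ : ℝ)‖ ≤ ‖z‖ + (1 - 2 * δ) := by
      refine (norm_add_le _ _).trans ?_
      rw [norm_mul, norm_neg, Complex.norm_I, one_mul, Complex.norm_real,
        Real.norm_of_nonneg (by linarith)]
    nlinarith
  have hlt : ‖w - 1‖ < ‖w + 1‖ := by
    have : 0 < w.re := by linarith
    nlinarith [norm_nonneg (w - 1)]
  have hξn : ‖ξ‖ = ‖w - 1‖ / ‖w + 1‖ := by rw [hξdef, norm_div]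
  have hξ1 : ‖ξ‖ < 1 := by rw [hξn, div_lt_one hwp]; exact hlt
  have hξ : ξ ∈ Metric.ball (0 : ℂ) 1 := by simpa using hξ1
  have hφξ : φ ξ = z := by
    have h2 : (1 + ξ) / (1 - ξ) = w := by
      rw [hξdef]
      field_simp
      ring_nf
    simp only [φ, h2, hw, mul_div_cancel₀ _ hδc]
    ring_nf
    simp
  have hφ0 : φ 0 = Complex.I := by simp [φ]
  have hb := norm_inv_le_exp_of_ne_zero_on_ball hVd hV0 hVM hξ
  have hVξ : V ξ = v z := by simp [V, hφξ]
  have hV0' : V 0 = v Complex.I := by simp [V, hφ0]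
  rw [hVξ, hV0'] at hb
  refine hb.trans (Real.exp_le_exp.2 ?_)
  -- From |w+1|² - |w-1|² = 4 Re w ≥ 2y one gets 1 - |ξ| ≥ y/|w+1|², and |w+1| ≤ 4|z|.
  have hgap : (1 - ‖ξ‖)⁻¹ ≤ 16 * ‖z‖ ^ 2 / y := by
    rw [inv_le_comm₀ (by linarith) (by positivity), inv_div, hξn]
    have e : 1 - ‖w - 1‖ / ‖w + 1‖ = (‖w + 1‖ - ‖w - 1‖) / ‖w + 1‖ := by field_simp
    rw [e, div_le_div_iff₀ (by positivity) hwp]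
    have h3 : 2 * y ≤ (‖w + 1‖ - ‖w - 1‖) * (2 * ‖w + 1‖) := by
      nlinarith [norm_nonneg (w - 1)]
    have h4 : ‖w + 1‖ ^ 2 ≤ 16 * ‖z‖ ^ 2 := by nlinarith
    have h5 : 0 ≤ ‖w + 1‖ - ‖w - 1‖ := by linarith
    have h6 : y * ‖w + 1‖ * ‖w + 1‖ ≤
        (‖w + 1‖ - ‖w - 1‖) * (16 * ‖z‖ ^ 2) * ‖w + 1‖ := by
      have : y ≤ (‖w + 1‖ - ‖w - 1‖) * ‖w + 1‖ := by linarith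
      have h7 := mul_le_mul this h4 (by positivity) (by positivity)
      nlinarith
    exact le_of_mul_le_mul_right h6 hwp
  have hMQ : M - Real.log ‖v Complex.I‖ + 1 ≤ Q * δ⁻¹ := by
    have h1 : 1 ≤ δ⁻¹ := (one_le_inv₀ hδ0).2 (by linarith)
    have h2 := neg_abs_le (Real.log ‖v Complex.I‖)
    have h3 := le_abs_self (Real.log c)
    have h4 : |Real.log ‖v Complex.I‖| + |Real.log c| + 1 ≤
        (|Real.log ‖v Complex.I‖| + |Real.log c| + 1) * δ⁻¹ :=
      le_mul_of_one_le_right (by positivity) h1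
    simp only [M, hQ]
    nlinarith
  have hX : 1 ≤ ‖z‖ ^ 3 / y ^ 2 := by
    rw [one_le_div (by positivity)]
    have : y ^ 2 ≤ ‖z‖ ^ 2 := by gcongr
    nlinarith [sq_nonneg ‖z‖]
  calc -Real.log ‖v Complex.I‖ + 2 * (M - Real.log ‖v Complex.I‖ + 1) / (1 - ‖ξ‖)
      ≤ Q * 1 + 2 * (Q * (2 * ‖z‖ / y)) * (16 * ‖z‖ ^ 2 / y) := by
        rw [div_eq_mul_inv]
        gcongr
        · have h2 := neg_abs_le (Real.log ‖v Complex.I‖)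
          have := abs_nonneg (Real.log c)
          rw [hQ]
          linarith
        · exact hMQ.trans (by gcongr)
    _ = Q * 1 + 64 * Q * (‖z‖ ^ 3 / y ^ 2) := by field_simp; ring
    _ ≤ Q * (‖z‖ ^ 3 / y ^ 2) + 64 * Q * (‖z‖ ^ 3 / y ^ 2) := by gcongr
    _ = 65 * Q * ‖z‖ ^ 3 / y ^ 2 := by ring

/-! ### Functions bounded on the real line and on a ray -/

theorem re_inv_sq_eq (s t : ℝ) :
    (((s : ℂ) + t * Complex.I) ^ 2)⁻¹.re = (s ^ 2 - t ^ 2) / (s ^ 2 + t ^ 2) ^ 2 := by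
  rw [Complex.inv_re, Complex.normSq_apply]
  simp [pow_two]
  ring

/-- A holomorphic function on the upper half-plane, bounded on `[-1, 1]`, that grows near the
real line at most like `exp (A / (Im z)^2)`, is bounded explicitly near `0`. -/
theorem norm_le_exp_of_bounded_on_segment {g : ℂ → ℂ} {A C : ℝ} (hA : 0 ≤ A) (hC : 1 ≤ C)
    (hd : DifferentiableOn ℂ g {z : ℂ | 0 < z.im}) (hc : ContinuousOn g {z : ℂ | 0 ≤ z.im})
    (hbase : ∀ s : ℝ, |s| ≤ 1 → ‖g s‖ ≤ C)
    (hgrowth : ∀ z : ℂ, |z.re| ≤ 1 → 0 < z.im → z.im ≤ 1 / 2 → ‖g z‖ ≤ Real.exp (A / z.im ^ 2))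
    {t : ℝ} (ht : 0 < t) (ht' : t < 1 / 2) :
    ‖g (t * Complex.I)‖ ≤ 2 * C * Real.exp (18 * A) := by
  -- The base is lifted to height ε < t, since g is holomorphic only above the line and the damping
  -- factor below is singular at ±1. Uniform continuity costs at most 1, and C + 1 ≤ 2C.
  obtain ⟨ε, hε0, hεt, hε⟩ : ∃ ε : ℝ, 0 < ε ∧ ε < t ∧
      ∀ s : ℝ, |s| ≤ 1 → ‖g (s + ε * Complex.I)‖ ≤ 2 * C := by
    have hK : IsCompact (Set.Icc (-1 : ℝ) 1 ×ℂ Set.Icc (0 : ℝ) 1) :=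
      isCompact_Icc.reProdIm isCompact_Icc
    have hu := hK.uniformContinuousOn_of_continuous (hc.mono fun z hz => hz.2.1)
    rw [Metric.uniformContinuousOn_iff] at hu
    obtain ⟨δ, hδ, h⟩ := hu 1 one_pos
    have hm : 0 < min (δ / 2) (t / 2) := by positivity
    refine ⟨min (δ / 2) (t / 2), hm, (min_le_right _ _).trans_lt (by linarith),
      fun s hs => ?_⟩
    have hs' := abs_le.1 hs
    have h1 := min_le_left (δ / 2) (t / 2)
    have h2 := min_le_right (δ / 2) (t / 2)
    generalize min (δ / 2) (t / 2) = ε at *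
    have := h (s + ε * Complex.I) ⟨by simpa using hs', by simpa using ⟨hm.le, by linarith⟩⟩
      s ⟨by simpa using hs', by simp⟩ (by
        simp [dist_eq_norm, abs_of_pos hm]
        linarith)
    rw [dist_eq_norm] at this
    have h3 := norm_sub_norm_le (g (s + ε * Complex.I)) (g s)
    linarith [hbase s hs]
  -- The triangle over [-1, 1] with apex i/2, truncated at height ε.
  set U : Set ℂ := {z | ε < z.im ∧ 2 * z.im < z.re + 1 ∧ 2 * z.im < 1 - z.re} with hU
  set K : Set ℂ := {z | ε ≤ z.im ∧ 2 * z.im ≤ z.re + 1 ∧ 2 * z.im ≤ 1 - z.re}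
  have hUK : closure U ⊆ K := by
    apply closure_minimal
    · rintro z ⟨h1, h2, h3⟩
      exact ⟨h1.le, h2.le, h3.le⟩
    · have : K = {z : ℂ | ε ≤ z.im} ∩ ({z : ℂ | 2 * z.im ≤ z.re + 1} ∩
          {z : ℂ | 2 * z.im ≤ 1 - z.re}) := rfl
      rw [this]
      refine (isClosed_le continuous_const Complex.continuous_im).inter
        ((isClosed_le ?_ ?_).inter (isClosed_le ?_ ?_)) <;> fun_prop
  have hUo : IsOpen U := by
    have : U = {z : ℂ | ε < z.im} ∩ ({z : ℂ | 2 * z.im < z.re + 1} ∩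
        {z : ℂ | 2 * z.im < 1 - z.re}) := rfl
    rw [this]
    refine (isOpen_lt continuous_const Complex.continuous_im).inter
      ((isOpen_lt ?_ ?_).inter (isOpen_lt ?_ ?_)) <;> fun_prop
  have hKim : ∀ z ∈ K, 0 < z.im := fun z hz => hε0.trans_le hz.1
  have hUb : Bornology.IsBounded U := by
    refine ((Metric.isBounded_Icc (-1 : ℝ) 1).reProdIm (Metric.isBounded_Icc (0 : ℝ) 1)).subset ?_
    rintro z ⟨h1, h2, h3⟩
    exact ⟨⟨by linarith, by linarith⟩, by linarith, by linarith⟩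
  -- A damping factor of modulus at most 1 in the triangle, because |Re z ± 1| ≥ 2 Im z there. On a
  -- slanted edge one of the two terms has real part 3/(25 (Im z)²), and 9 · 3/25 ≥ 1, so the factor
  -- cancels the growth exp(A/(Im z)²).
  let M : ℂ → ℂ := fun z => Complex.exp (-(9 * A : ℝ) * (((z + 1) ^ 2)⁻¹ + ((z - 1) ^ 2)⁻¹))
  have hM : ∀ z : ℂ, ‖M z‖ = Real.exp (-(9 * A) *
      (((z.re + 1) ^ 2 - z.im ^ 2) / ((z.re + 1) ^ 2 + z.im ^ 2) ^ 2 +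
      ((z.re - 1) ^ 2 - z.im ^ 2) / ((z.re - 1) ^ 2 + z.im ^ 2) ^ 2)) := by
    intro z
    have e1 : z + 1 = ((z.re + 1 : ℝ) : ℂ) + z.im * Complex.I := by
      apply Complex.ext <;> simp
    have e2 : z - 1 = ((z.re - 1 : ℝ) : ℂ) + z.im * Complex.I := by
      apply Complex.ext <;> simp
    simp only [M, Complex.norm_exp, e1, e2]
    rw [← Complex.ofReal_neg, Complex.re_ofReal_mul, Complex.add_re, re_inv_sq_eq, re_inv_sq_eq]
  have hMd : DifferentiableOn ℂ M K := by
    intro z hz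
    have h0 := hKim z hz
    have h1 : (z + 1) ^ 2 ≠ 0 := by
      refine pow_ne_zero 2 fun h => ?_
      have := congrArg Complex.im h
      simp at this
      linarith
    have h2 : (z - 1) ^ 2 ≠ 0 := by
      refine pow_ne_zero 2 fun h => ?_
      have := congrArg Complex.im h
      simp at this
      linarith
    apply DifferentiableAt.differentiableWithinAt
    simp only [M]
    fun_prop (disch := assumption)
  have hdiff : DifferentiableOn ℂ (fun z => g z * M z) K :=
    (hd.mono hKim).mul hMd
  have hfront : ∀ z ∈ frontier U, ‖g z * M z‖ ≤ 2 * C := by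
    intro z hz
    have hzK : z ∈ K := hUK hz.1
    have hzU : z ∉ U := by rw [← hUo.interior_eq]; exact hz.2
    obtain ⟨h1, h2, h3⟩ := hzK
    have h0 := hKim z ⟨h1, h2, h3⟩
    have hp : 0 ≤ ((z.re + 1) ^ 2 - z.im ^ 2) / ((z.re + 1) ^ 2 + z.im ^ 2) ^ 2 := by
      apply div_nonneg _ (by positivity)
      nlinarith
    have hq : 0 ≤ ((z.re - 1) ^ 2 - z.im ^ 2) / ((z.re - 1) ^ 2 + z.im ^ 2) ^ 2 := by
      apply div_nonneg _ (by positivity)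
      nlinarith
    have hre : |z.re| ≤ 1 := abs_le.2 ⟨by linarith, by linarith⟩
    rw [norm_mul, hM]
    generalize hP : ((z.re + 1) ^ 2 - z.im ^ 2) / ((z.re + 1) ^ 2 + z.im ^ 2) ^ 2 = P at *
    generalize hQ : ((z.re - 1) ^ 2 - z.im ^ 2) / ((z.re - 1) ^ 2 + z.im ^ 2) ^ 2 = Q at *
    have edge : ∀ x : ℝ, x ^ 2 = 4 * z.im ^ 2 →
        (x ^ 2 - z.im ^ 2) / (x ^ 2 + z.im ^ 2) ^ 2 = 3 / 25 / z.im ^ 2 := by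
      intro x hx
      rw [hx]
      field_simp
      ring
    have slanted : 3 / 25 / z.im ^ 2 ≤ P + Q →
        ‖g z‖ * Real.exp (-(9 * A) * (P + Q)) ≤ 2 * C := by
      intro h
      calc ‖g z‖ * Real.exp (-(9 * A) * (P + Q))
          ≤ Real.exp (A / z.im ^ 2) * Real.exp (-(A / z.im ^ 2)) := by
            gcongr
            · exact hgrowth z hre h0 (by linarith)
            · have : 9 * A * (3 / 25 / z.im ^ 2) ≤ 9 * A * (P + Q) := by gcongr
              have h' : 0 ≤ A / z.im ^ 2 := by positivity
              have e : 9 * A * (3 / 25 / z.im ^ 2) = 27 / 25 * (A / z.im ^ 2) := by ring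
              linarith
        _ = 1 := by rw [← Real.exp_add]; simp
        _ ≤ 2 * C := by linarith
    by_cases c1 : ε < z.im
    · by_cases c2 : 2 * z.im < z.re + 1
      · have c3 : 2 * z.im = 1 - z.re := le_antisymm h3 (not_lt.1 fun c3 => hzU ⟨c1, c2, c3⟩)
        apply slanted
        have := edge (z.re - 1) (by nlinarith)
        linarith
      · have c3 : 2 * z.im = z.re + 1 := le_antisymm h2 (not_lt.1 c2)
        apply slanted
        have := edge (z.re + 1) (by nlinarith)
        linarith
    · have c3 : z.im = ε := le_antisymm (not_lt.1 c1) h1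
      have hz' : z = z.re + ε * Complex.I := by rw [← c3, Complex.re_add_im]
      have := hε z.re hre
      rw [← hz'] at this
      refine (mul_le_of_le_one_right (norm_nonneg _) ?_).trans this
      rw [Real.exp_le_one_iff]
      have : 0 ≤ 9 * A * (P + Q) := by positivity
      linarith
  have hmem : (t * Complex.I : ℂ) ∈ U := by
    simp only [hU, Set.mem_ofPred_eq]
    simp
    exact ⟨hεt, by linarith⟩
  have hmax := Complex.norm_le_of_forall_mem_frontier_norm_le hUb
    (DifferentiableOn.diffContOnCl (hdiff.mono hUK)) hfront (subset_closure hmem)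
  rw [norm_mul, hM] at hmax
  -- At it both terms equal (1-t²)/(1+t²)² ≤ 1, so removing the damping costs at most exp(18A).
  have hle : (1 - t ^ 2) / (1 + t ^ 2) ^ 2 ≤ 1 := by
    rw [div_le_one (by positivity)]
    nlinarith [sq_nonneg t]
  simp at hmax
  have : Real.exp (-(18 * A)) ≤ Real.exp (-(9 * A * ((1 - t ^ 2) / (1 + t ^ 2) ^ 2 +
      (1 - t ^ 2) / (1 + t ^ 2) ^ 2))) := by
    gcongr Real.exp ?_
    nlinarith
  calc ‖g (t * Complex.I)‖ = ‖g (t * Complex.I)‖ * Real.exp (-(18 * A)) * Real.exp (18 * A) := by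
        rw [mul_assoc, ← Real.exp_add]; simp
    _ ≤ 2 * C * Real.exp (18 * A) := by
        gcongr ?_ * _
        exact (mul_le_mul_of_nonneg_left this (norm_nonneg _)).trans hmax

/-- A function bounded on the real line and bounded by `exp (A ‖z‖^3 / (Im z)^2)` away from the
origin is of exponential type. -/
theorem exists_norm_le_exp_of_bounded_on_real {f : ℂ → ℂ} {A C : ℝ} (hA : 0 ≤ A) (hC : 1 ≤ C)
    (hd : DifferentiableOn ℂ f {z : ℂ | 0 < z.im}) (hc : ContinuousOn f {z : ℂ | 0 ≤ z.im})
    (hbase : ∀ s : ℝ, ‖f s‖ ≤ C)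
    (hgrowth : ∀ z : ℂ, 0 < z.im → 1 ≤ ‖z‖ → ‖f z‖ ≤ Real.exp (A * ‖z‖ ^ 3 / z.im ^ 2)) :
    ∃ K B : ℝ, ∀ z : ℂ, 0 ≤ z.im → ‖f z‖ ≤ K * Real.exp (B * ‖z‖) := by
  obtain ⟨K₀, hK₀⟩ : ∃ K₀, ∀ z : ℂ, 0 ≤ z.im → ‖z‖ ≤ 4 → ‖f z‖ ≤ K₀ := by
    have hK : IsCompact (Metric.closedBall (0 : ℂ) 4 ∩ {z : ℂ | 0 ≤ z.im}) :=
      (isCompact_closedBall _ _).inter_right (isClosed_le continuous_const Complex.continuous_im)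
    obtain ⟨K₀, h⟩ := hK.exists_bound_of_continuousOn (hc.mono Set.inter_subset_right)
    exact ⟨K₀, fun z hz hz4 => h z ⟨by simpa using hz4, hz⟩⟩
  -- 576 = 18 · 32: the factor 18 is from the triangle estimate, 32 from the rescaling below.
  have main : ∀ z : ℂ, 0 ≤ z.im → 4 < ‖z‖ → ‖f z‖ ≤ 2 * C * Real.exp (576 * A * ‖z‖) := by
    intro z hz hz4
    rcases hz.eq_or_lt with h0 | h0
    · have : z = z.re := by apply Complex.ext <;> simp [← h0]
      rw [this]
      have h1 : 1 ≤ Real.exp (576 * A * ‖((z.re : ℝ) : ℂ)‖) := Real.one_le_exp (by positivity)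
      nlinarith [hbase z.re]
    have htri : ‖z‖ ≤ |z.re| + z.im := by
      simpa [abs_of_pos h0] using Complex.norm_le_abs_re_add_abs_im z
    -- Away from the line |z| and Im z are comparable and the growth hypothesis is already of
    -- exponential type. Near the line, the triangle estimate is applied after moving Re z to 0 and
    -- scaling by r = |Re z|/2, a size that keeps the triangle at distance at least r from the
    -- origin.
    by_cases hy : |z.re| < 8 * z.im
    · refine (hgrowth z h0 (by linarith)).trans ?_
      have h1 : A * ‖z‖ ^ 3 / z.im ^ 2 ≤ 576 * A * ‖z‖ := by
        rw [div_le_iff₀ (by positivity)]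
        have : ‖z‖ ^ 2 ≤ 576 * z.im ^ 2 := by nlinarith [norm_nonneg z]
        calc A * ‖z‖ ^ 3 = A * ‖z‖ * ‖z‖ ^ 2 := by ring
          _ ≤ A * ‖z‖ * (576 * z.im ^ 2) := by gcongr
          _ = _ := by ring
      have := Real.exp_pos (576 * A * ‖z‖)
      nlinarith [Real.exp_le_exp.2 h1]
    · push Not at hy
      set r : ℝ := |z.re| / 2 with hr
      have hr1 : 1 ≤ r := by rw [hr]; linarith
      have hr0 : 0 < r := by linarith
      let g : ℂ → ℂ := fun ζ => f (z.re + r * ζ)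
      have him : ∀ ζ : ℂ, (z.re + r * ζ : ℂ).im = r * ζ.im := by intro ζ; simp
      have hre : ∀ ζ : ℂ, (z.re + r * ζ : ℂ).re = z.re + r * ζ.re := by intro ζ; simp
      have hgd : DifferentiableOn ℂ g {z : ℂ | 0 < z.im} := by
        refine hd.comp (by fun_prop) fun ζ hζ => ?_
        have : 0 < r * ζ.im := mul_pos hr0 hζ
        simpa [him] using this
      have hgc : ContinuousOn g {z : ℂ | 0 ≤ z.im} := by
        refine hc.comp (by fun_prop) fun ζ hζ => ?_
        have : 0 ≤ r * ζ.im := mul_nonneg hr0.le hζ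
        simpa [him] using this
      have hgb : ∀ s : ℝ, |s| ≤ 1 → ‖g s‖ ≤ C := by
        intro s _
        simpa [g] using hbase (z.re + r * s)
      have hgg : ∀ ζ : ℂ, |ζ.re| ≤ 1 → 0 < ζ.im → ζ.im ≤ 1 / 2 →
          ‖g ζ‖ ≤ Real.exp (32 * A * |z.re| / ζ.im ^ 2) := by
        intro ζ h1 h2 h3
        have h1' := abs_le.1 h1
        have hlow : r ≤ |z.re + r * ζ.re| := by
          have h5 := abs_sub_abs_le_abs_sub z.re (-(r * ζ.re))
          rw [abs_neg, abs_mul, abs_of_pos hr0, sub_neg_eq_add] at h5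
          have : r * |ζ.re| ≤ r * 1 := by gcongr
          linarith
        have hnlow : r ≤ ‖(z.re + r * ζ : ℂ)‖ := by
          refine hlow.trans ?_
          rw [← hre]
          exact Complex.abs_re_le_norm _
        have hnup : ‖(z.re + r * ζ : ℂ)‖ ≤ 2 * |z.re| := by
          refine (Complex.norm_le_abs_re_add_abs_im _).trans ?_
          rw [hre, him, abs_of_pos (mul_pos hr0 h2)]
          have h5 := abs_add_le z.re (r * ζ.re)
          rw [abs_mul, abs_of_pos hr0] at h5
          have : r * |ζ.re| ≤ r * 1 := by gcongr
          have : r * ζ.im ≤ r * (1 / 2) := by gcongr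
          linarith
        refine (hgrowth _ (by rw [him]; positivity) (hr1.trans hnlow)).trans ?_
        rw [him]
        gcongr Real.exp ?_
        calc A * ‖(z.re + r * ζ : ℂ)‖ ^ 3 / (r * ζ.im) ^ 2
            ≤ A * (2 * |z.re|) ^ 3 / (r * ζ.im) ^ 2 := by gcongr
          _ = 32 * A * |z.re| / ζ.im ^ 2 := by
            have : |z.re| = 2 * r := by rw [hr]; ring
            rw [this]
            field_simp
            ring
      have ht : z.im / r < 1 / 2 := by
        rw [div_lt_iff₀ hr0]
        linarith
      have h := norm_le_exp_of_bounded_on_segment (A := 32 * A * |z.re|) (by positivity) hC hgd hgc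
        hgb hgg (div_pos h0 hr0) ht
      have hgz : g ((z.im / r : ℝ) * Complex.I) = f z := by
        have hrc : (r : ℂ) ≠ 0 := by exact_mod_cast hr0.ne'
        have : (z.re : ℂ) + r * ((z.im / r : ℝ) * Complex.I) = z := by
          push_cast
          rw [← mul_assoc, mul_div_cancel₀ _ hrc, Complex.re_add_im]
        simp only [g, this]
      rw [hgz] at h
      refine h.trans ?_
      gcongr 2 * C * Real.exp ?_
      have := Complex.abs_re_le_norm z
      nlinarith
  have hK0 : 0 ≤ K₀ := (norm_nonneg _).trans (hK₀ 0 (by simp) (by simp))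
  refine ⟨K₀ + 2 * C, 576 * A, fun z hz => ?_⟩
  have h1 : 1 ≤ Real.exp (576 * A * ‖z‖) := Real.one_le_exp (by positivity)
  rcases le_or_gt ‖z‖ 4 with h4 | h4
  · have := hK₀ z hz h4
    nlinarith
  · have := main z hz h4
    nlinarith

/-- **Phragmén-Lindelöf principle** in the upper half-plane for functions of exponential type
bounded on the real line and on a ray. -/
theorem norm_le_of_bounded_on_real_and_ray {f : ℂ → ℂ} {C K B β : ℝ} (hβ0 : 0 < β) (hβ1 : β < 1)
    (hd : DifferentiableOn ℂ f {z : ℂ | 0 < z.im}) (hc : ContinuousOn f {z : ℂ | 0 ≤ z.im})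
    (hbase : ∀ s : ℝ, ‖f s‖ ≤ C)
    (hray : ∀ r : ℝ, 0 ≤ r → ‖f (Complex.exp (Complex.I * Real.pi * β) * r)‖ ≤ C)
    (hgrowth : ∀ z : ℂ, 0 ≤ z.im → ‖f z‖ ≤ K * Real.exp (B * ‖z‖)) {z : ℂ} (hz : 0 < z.im) :
    ‖f z‖ ≤ C := by
  have hexpim : ∀ ζ : ℂ, 0 ≤ ζ.im → ζ.im ≤ Real.pi → 0 ≤ (Complex.exp ζ).im := by
    intro ζ h1 h2
    rw [Complex.exp_im]
    exact mul_nonneg (Real.exp_pos _).le (Real.sin_nonneg_of_nonneg_of_le_pi h1 h2)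
  have hexpim' : ∀ ζ : ℂ, 0 < ζ.im → ζ.im < Real.pi → 0 < (Complex.exp ζ).im := by
    intro ζ h1 h2
    rw [Complex.exp_im]
    exact mul_pos (Real.exp_pos _) (Real.sin_pos_of_pos_of_lt_pi h1 h2)
  have hpi := Real.pi_pos
  -- The substitution z = exp ζ turns a sector into a strip of width b - a < π. Exponential type
  -- becomes exp(|B| exp|Re ζ|), admissible since 1 < π/(b - a).
  have strip : ∀ a b : ℝ, 0 ≤ a → b ≤ Real.pi → a < b → b - a < Real.pi →
      (∀ ζ : ℂ, ζ.im = a → ‖f (Complex.exp ζ)‖ ≤ C) →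
      (∀ ζ : ℂ, ζ.im = b → ‖f (Complex.exp ζ)‖ ≤ C) →
      ∀ ζ : ℂ, a ≤ ζ.im → ζ.im ≤ b → ‖f (Complex.exp ζ)‖ ≤ C := by
    intro a b ha hb hab hlt h1 h2 ζ h3 h4
    have hd' : DiffContOnCl ℂ (fun ζ => f (Complex.exp ζ)) (Complex.im ⁻¹' Set.Ioo a b) := by
      constructor
      · refine hd.comp Complex.differentiable_exp.differentiableOn fun ζ hζ => ?_
        exact hexpim' ζ (ha.trans_lt hζ.1) (hζ.2.trans_le hb)
      · refine hc.comp Complex.continuous_exp.continuousOn fun ζ hζ => ?_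
        have hcl : closure (Complex.im ⁻¹' Set.Ioo a b) ⊆ Complex.im ⁻¹' Set.Icc a b :=
          closure_minimal (Set.preimage_mono Set.Ioo_subset_Icc_self)
            (isClosed_Icc.preimage Complex.continuous_im)
        have := hcl hζ
        exact hexpim ζ (ha.trans this.1) (this.2.trans hb)
    refine PhragmenLindelof.horizontal_strip (f := fun ζ => f (Complex.exp ζ)) hd' ⟨1, ?_, |B|, ?_⟩ h1 h2 h3 h4
    · rw [lt_div_iff₀ (by linarith)]
      linarith
    · refine Asymptotics.IsBigO.of_bound |K| ?_
      refine Filter.Eventually.filter_mono inf_le_right ?_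
      rw [Filter.eventually_principal]
      intro ζ hζ
      have h5 := hgrowth (Complex.exp ζ) (hexpim ζ (ha.trans hζ.1.le) (hζ.2.le.trans hb))
      rw [Real.norm_of_nonneg (Real.exp_pos _).le]
      refine h5.trans ?_
      rw [Complex.norm_exp, one_mul]
      gcongr
      · exact le_abs_self K
      · exact le_abs_self B
      · exact le_abs_self _
  have hz0 : z ≠ 0 := by
    rintro rfl
    simp at hz
  have hlogim : (Complex.log z).im = z.arg := Complex.log_im z
  have harg0 : 0 ≤ z.arg := Complex.arg_nonneg_iff.2 hz.le
  have hreal : ∀ ζ : ℂ, ζ.im = 0 ∨ ζ.im = Real.pi → ‖f (Complex.exp ζ)‖ ≤ C := by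
    intro ζ hζ
    have : Complex.exp ζ = (Complex.exp ζ).re := by
      apply Complex.ext
      · simp
      · rw [Complex.exp_im]
        rcases hζ with h | h <;> simp [h]
    rw [this]
    exact hbase _
  have hmid : ∀ ζ : ℂ, ζ.im = Real.pi * β → ‖f (Complex.exp ζ)‖ ≤ C := by
    intro ζ hζ
    have : Complex.exp ζ = Complex.exp (Complex.I * Real.pi * β) * (Real.exp ζ.re : ℝ) := by
      rw [Complex.ofReal_exp, ← Complex.exp_add]
      congr 1
      apply Complex.ext <;> simp [hζ]
    rw [this]
    exact hray _ (Real.exp_pos _).le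
  have hπβ : 0 < Real.pi * β := by positivity
  have hπβ' : Real.pi * β < Real.pi := by nlinarith
  rw [← Complex.exp_log hz0]
  rcases le_total z.arg (Real.pi * β) with h | h
  · exact strip 0 (Real.pi * β) le_rfl hπβ'.le hπβ (by linarith) (fun ζ h => hreal ζ (Or.inl h))
      hmid _ (by rw [hlogim]; exact harg0) (by rw [hlogim]; exact h)
  · exact strip (Real.pi * β) Real.pi hπβ.le le_rfl hπβ' (by linarith) hmid
      (fun ζ h => hreal ζ (Or.inr h)) _ (by rw [hlogim]; exact h)
      (by rw [hlogim]; exact Complex.arg_le_pi z)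

/-! ### Cauchy's theorem in the Hardy space -/

open MeasureTheory Filter Topology in
/-- A version of the convergence theorem of Vitali: products of an `L²`-bounded sequence with a
sequence dominated in `L²`. -/
theorem tendsto_integral_mul_of_eLpNorm_two_le {α : Type*} {m : MeasurableSpace α} {μ : Measure α}
    {f g : ℕ → α → ℂ} {φ h : α → ℂ} {C : ℝ≥0} (hf : ∀ n, AEStronglyMeasurable (f n) μ)
    (hg : ∀ n, AEStronglyMeasurable (g n) μ) (hfC : ∀ n, eLpNorm (f n) 2 μ ≤ C)
    (hφ : MemLp φ 2 μ) (hgφ : ∀ n x, ‖g n x‖ ≤ ‖φ x‖)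
    (hlim : ∀ᵐ x ∂μ, Tendsto (fun n => f n x * g n x) atTop (𝓝 (h x))) :
    Tendsto (fun n => ∫ x, f n x * g n x ∂μ) atTop (𝓝 (∫ x, h x ∂μ)) := by
  -- Hölder on a set s: uniform integrability and tightness of the products are inherited from the
  -- single function φ.
  have hind : ∀ n (s : Set α), MeasurableSet s →
      eLpNorm (s.indicator (f n * g n)) 1 μ ≤ C * eLpNorm (s.indicator φ) 2 μ := by
    intro n s hs
    have e : s.indicator (f n * g n) = f n • s.indicator (g n) := by
      funext x
      by_cases hx : x ∈ s <;> simp [hx]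
    rw [e]
    refine (eLpNorm_smul_le_mul_eLpNorm (p := 2) (q := 2) ((hg n).indicator hs) (hf n)).trans ?_
    gcongr
    · exact hfC n
    · refine eLpNorm_mono fun x => ?_
      by_cases hx : x ∈ s <;> simp [hx, hgφ n x]
  have hmeas : ∀ n, AEStronglyMeasurable (f n * g n) μ := fun n => (hf n).mul (hg n)
  have hL1 : ∀ n, eLpNorm (f n * g n) 1 μ ≤ C * eLpNorm φ 2 μ := fun n => by
    simpa using hind n Set.univ MeasurableSet.univ
  have hfin : C * eLpNorm φ 2 μ < ∞ := ENNReal.mul_lt_top ENNReal.coe_lt_top hφ.2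
  have hhmem : MemLp h 1 μ := by
    refine ⟨aestronglyMeasurable_of_tendsto_ae atTop hmeas hlim, ?_⟩
    refine (Lp.eLpNorm_lim_le_liminf_eLpNorm hmeas h hlim).trans_lt (lt_of_le_of_lt ?_ hfin)
    exact liminf_le_of_le (by isBoundedDefault) fun b hb => by
      obtain ⟨n, hn⟩ := hb.exists
      exact hn.trans (hL1 n)
  have hui : UnifIntegrable (fun n => f n * g n) 1 μ := by
    intro ε hε
    obtain ⟨δ, hδ, H⟩ := hφ.eLpNorm_indicator_le one_le_two (by simp)
      (ε := ε / (C + 1)) (by positivity)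
    refine ⟨δ, hδ, fun n s hs hμs => (hind n s hs).trans ?_⟩
    calc C * eLpNorm (s.indicator φ) 2 μ
        ≤ ENNReal.ofReal C * ENNReal.ofReal (ε / (C + 1)) := by
          rw [ENNReal.ofReal_coe_nnreal]
          gcongr
          exact H s hs hμs
      _ = ENNReal.ofReal (C * (ε / (C + 1))) := (ENNReal.ofReal_mul (by positivity)).symm
      _ ≤ ENNReal.ofReal ε := by
          apply ENNReal.ofReal_le_ofReal
          rw [← mul_div_assoc, div_le_iff₀ (by positivity)]
          nlinarith [C.2]
  have hut : UnifTight (fun n => f n * g n) 1 μ := by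
    intro ε hε
    obtain ⟨s, hs, hμs, H⟩ := hφ.exists_eLpNorm_indicator_compl_lt (by simp)
      (ε := ε / (C + 1)) (by simp [hε.ne'])
    refine ⟨s, hμs.ne, fun n => (hind n _ hs.compl).trans ?_⟩
    calc C * eLpNorm (sᶜ.indicator φ) 2 μ ≤ (C + 1) * (ε / (C + 1)) := by
          gcongr
          exact le_self_add
      _ = ε := ENNReal.mul_div_cancel (by simp) (by simp)
  have := tendsto_Lp_of_tendsto_ae le_rfl (by simp) hmeas hhmem hui hut hlim
  exact tendsto_integral_of_L1' h hhmem.1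
    (Eventually.of_forall fun n => memLp_one_iff_integrable.1 ⟨hmeas n, (hL1 n).trans_lt hfin⟩) this

section

open MeasureTheory Filter Topology

theorem add_mul_I_sub_conj_ne_zero {w : ℂ} (hw : 0 < w.im) (x : ℝ) {y : ℝ} (hy : 0 ≤ y) :
    (x : ℂ) + y * Complex.I - conj w ≠ 0 := by
  intro h
  have := congrArg Complex.im h
  simp at this
  linarith

theorem sq_norm_add_mul_I_sub_conj (w : ℂ) (x y : ℝ) :
    ‖(x : ℂ) + y * Complex.I - conj w‖ ^ 2 = (x - w.re) ^ 2 + (y + w.im) ^ 2 := by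
  rw [Complex.sq_norm, Complex.normSq_apply]
  simp
  ring

theorem norm_inv_sub_conj_le {w : ℂ} (hw : 0 < w.im) (x : ℝ) {y : ℝ} (hy : 0 ≤ y) :
    ‖((x : ℂ) + y * Complex.I - conj w)⁻¹‖ ≤ ‖((x : ℂ) - conj w)⁻¹‖ := by
  rw [norm_inv, norm_inv]
  have h0 := add_mul_I_sub_conj_ne_zero hw x le_rfl
  simp only [Complex.ofReal_zero, zero_mul, add_zero] at h0
  have hpos : 0 < ‖(x : ℂ) - conj w‖ := norm_pos_iff.2 h0
  gcongr
  have h1 := sq_norm_add_mul_I_sub_conj w x y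
  have h2 := sq_norm_add_mul_I_sub_conj w x 0
  simp only [Complex.ofReal_zero, zero_mul, add_zero, zero_add] at h2
  apply le_of_sq_le_sq _ (norm_nonneg _)
  rw [h1, h2]
  nlinarith

theorem integrable_inv_sq_add_sq (a : ℝ) {c : ℝ} (hc : 0 < c) :
    Integrable fun x : ℝ => ((x - a) ^ 2 + c ^ 2)⁻¹ := by
  have h := ((integrable_inv_one_add_sq.comp_div hc.ne').comp_sub_right a).const_mul (c ^ 2)⁻¹
  refine h.congr (Eventually.of_forall fun x => ?_)
  field_simp
  ring

theorem memLp_inv_sub_conj {w : ℂ} (hw : 0 < w.im) {y : ℝ} (hy : 0 ≤ y) :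
    MemLp (fun x : ℝ => ((x : ℂ) + y * Complex.I - conj w)⁻¹) 2 := by
  have hcont : Continuous fun x : ℝ => ((x : ℂ) + y * Complex.I - conj w)⁻¹ :=
    Continuous.inv₀ (by fun_prop) fun x => add_mul_I_sub_conj_ne_zero hw x hy
  rw [memLp_two_iff_integrable_sq_norm hcont.aestronglyMeasurable]
  refine (integrable_inv_sq_add_sq w.re (add_pos_of_nonneg_of_pos hy hw)).congr
    (Eventually.of_forall fun x => ?_)
  simp only [norm_inv, inv_pow, sq_norm_add_mul_I_sub_conj]

theorem continuous_horizontal {f : ℂ → ℂ} (hf : DifferentiableOn ℂ f {z : ℂ | 0 < z.im}) {y : ℝ}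
    (hy : 0 < y) : Continuous fun x : ℝ => f (x + y * Complex.I) :=
  hf.continuousOn.comp_continuous (by fun_prop) fun x => by simpa using hy

theorem eLpNorm_two_le_of_lintegral_le {f : ℝ → ℂ} {C : ℝ≥0} (h : ∫⁻ x, ‖f x‖ₑ ^ 2 ≤ C) :
    eLpNorm f 2 volume ≤ (NNReal.sqrt C : ℝ≥0) := by
  have e := eLpNorm_nnreal_pow_eq_lintegral (f := f) (p := 2) (μ := volume) two_ne_zero
  have h2 : ∀ a : ℝ≥0∞, a ^ ((2 : ℝ≥0) : ℝ) = a ^ 2 := fun a => by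
    rw [NNReal.coe_ofNat, ← ENNReal.rpow_natCast]; norm_num
  simp only [h2] at e
  have h3 : (((2 : ℝ≥0)) : ℝ≥0∞) = 2 := by norm_num
  rw [h3] at e
  rw [← e] at h
  refine le_of_not_gt fun hlt => absurd h (not_le_of_gt ?_)
  calc (C : ℝ≥0∞) = ((NNReal.sqrt C : ℝ≥0) : ℝ≥0∞) ^ 2 := by
        rw [← ENNReal.coe_pow, NNReal.sq_sqrt]
    _ < _ := ENNReal.pow_lt_pow_left two_ne_zero hlt

/-- Finite integrability produces arbitrarily large points where both `S x` and `S (-x)` are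
small. -/
theorem exists_ge_lt_of_lintegral_ne_top {S : ℝ → ℝ≥0∞} (hS : Measurable S)
    (hfin : ∫⁻ x, S x ≠ ∞) (T : ℝ) {ε : ℝ≥0∞} (hε : ε ≠ 0) : ∃ x ≥ T, S x + S (-x) < ε := by
  by_contra! hcon
  have hneg : ∫⁻ x, S (-x) = ∫⁻ x, S x :=
    (Measure.measurePreserving_neg (volume : Measure ℝ)).lintegral_comp hS
  have h1 : ∫⁻ x, (S x + S (-x)) ≠ ∞ := by
    rw [lintegral_add_left hS, hneg]
    exact ENNReal.add_ne_top.2 ⟨hfin, hfin⟩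
  apply h1
  rw [eq_top_iff]
  calc (∞ : ℝ≥0∞) = ∫⁻ _ in Set.Ici T, ε := by simp [ENNReal.mul_top hε]
    _ ≤ ∫⁻ x in Set.Ici T, (S x + S (-x)) := setLIntegral_mono' measurableSet_Ici hcon
    _ ≤ _ := setLIntegral_le_lintegral _ _

theorem lintegral_mul_inv_sub_conj_le {f : ℂ → ℂ} {C : ℝ≥0}
    (hf : DifferentiableOn ℂ f {z : ℂ | 0 < z.im}) {w : ℂ} (hw : 0 < w.im) {y : ℝ} (hy : 0 < y)
    (hC : ∫⁻ x : ℝ, ‖f (x + y * Complex.I)‖ₑ ^ 2 ≤ C) :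
    ∫⁻ x : ℝ, ‖f (x + y * Complex.I) * ((x : ℂ) + y * Complex.I - conj w)⁻¹‖ₑ ≤
      (NNReal.sqrt C : ℝ≥0) *
        eLpNorm (fun x : ℝ => ((x : ℂ) + y * Complex.I - conj w)⁻¹) 2 volume := by
  rw [← eLpNorm_one_eq_lintegral_enorm]
  refine (eLpNorm_smul_le_mul_eLpNorm (p := 2) (q := 2) (memLp_inv_sub_conj hw hy.le).1
    (continuous_horizontal hf hy).aestronglyMeasurable).trans ?_
  gcongr
  exact eLpNorm_two_le_of_lintegral_le hC

/-- Dominated convergence with dominating function |x - conj w|⁻². With Cauchy-Schwarz it makes the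
L¹-norm of f/(z - conj w) on the line at height n tend to 0. -/
theorem tendsto_eLpNorm_inv_sub_conj {w : ℂ} (hw : 0 < w.im) :
    Tendsto (fun n : ℕ => eLpNorm (fun x : ℝ => ((x : ℂ) + (n : ℝ) * Complex.I - conj w)⁻¹) 2
      volume) atTop (𝓝 0) := by
  have hz : Tendsto (fun n : ℕ => ∫⁻ x : ℝ,
      ‖((x : ℂ) + (n : ℝ) * Complex.I - conj w)⁻¹‖ₑ ^ (2 : ℝ)) atTop (𝓝 (∫⁻ _ : ℝ, 0)) := by
    refine tendsto_lintegral_of_dominated_convergence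
      (fun x : ℝ => ‖((x : ℂ) - conj w)⁻¹‖ₑ ^ (2 : ℝ)) (fun n => ?_)
      (fun n => Eventually.of_forall fun x => ?_) ?_ (Eventually.of_forall fun x => ?_)
    · fun_prop
    · show _ ^ (2 : ℝ) ≤ _ ^ (2 : ℝ)
      gcongr ?_ ^ (2 : ℝ)
      exact enorm_le_iff_norm_le.2 (norm_inv_sub_conj_le hw x (Nat.cast_nonneg n))
    · have h := (memLp_inv_sub_conj hw le_rfl).2
      simp only [Complex.ofReal_zero, zero_mul, add_zero] at h
      have := lintegral_rpow_enorm_lt_top_of_eLpNorm_lt_top two_ne_zero (by simp) h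
      simpa using this.ne
    · have h1 : Tendsto (fun n : ℕ => ((x : ℂ) + (n : ℝ) * Complex.I - conj w)⁻¹) atTop (𝓝 0) := by
        rw [tendsto_zero_iff_norm_tendsto_zero]
        refine squeeze_zero' (Eventually.of_forall fun n => norm_nonneg _) ?_
          tendsto_inv_atTop_nhds_zero_nat
        filter_upwards [eventually_gt_atTop 0] with n hn
        rw [norm_inv]
        have hn' : (0 : ℝ) < n := by exact_mod_cast hn
        gcongr
        refine le_trans ?_ (Complex.abs_im_le_norm _)
        simp
        rw [abs_of_pos (by positivity)]
        linarith
      have h2 := ((ENNReal.continuous_rpow_const (y := (2 : ℝ))).tendsto 0).comp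
        (continuous_enorm.tendsto' (0 : ℂ) 0 enorm_zero |>.comp h1)
      simpa using! h2
  simp only [lintegral_zero] at hz
  have h3 := ((ENNReal.continuous_rpow_const (y := (1 / 2 : ℝ))).tendsto 0).comp hz
  simp only [eLpNorm_eq_lintegral_rpow_enorm_toReal two_ne_zero ENNReal.ofNat_ne_top]
  simpa using! h3

/-- For a function integrable on horizontal lines, uniformly in the height, the modulus of the
integral over a line is at most the `L¹`-norm on any higher line. -/
theorem enorm_integral_horizontal_le {h : ℂ → ℂ} {K : ℝ≥0∞}
    (hhd : DifferentiableOn ℂ h {z : ℂ | 0 < z.im}) (hKfin : K ≠ ∞)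
    (hK : ∀ s : ℝ, 0 < s → ∫⁻ x : ℝ, ‖h (x + s * Complex.I)‖ₑ ≤ K) {y Y : ℝ} (hy : 0 < y)
    (hY : y < Y) :
    ‖∫ x : ℝ, h (x + y * Complex.I)‖ₑ ≤ ∫⁻ x : ℝ, ‖h (x + Y * Complex.I)‖ₑ := by
  have hint : Integrable fun x : ℝ => h (x + y * Complex.I) :=
    ⟨(continuous_horizontal hhd hy).aestronglyMeasurable, (hK y hy).trans_lt hKfin.lt_top⟩
  -- Clamping the height at y gives an integrand continuous on the whole plane, unchanged for s ≥ y.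
  let H : ℝ × ℝ → ℂ := fun p => h (p.1 + (max p.2 y : ℝ) * Complex.I)
  have hHc : Continuous H :=
    hhd.continuousOn.comp_continuous (by fun_prop) fun p => by simp [hy]
  -- S(X) dominates the integral over the vertical side at X. By Tonelli S is integrable, so
  -- suitable rectangles with both vertical sides tending to 0 exist.
  let S : ℝ → ℝ≥0∞ := fun X => ∫⁻ s in Set.Ioc y Y, ‖H (X, s)‖ₑ
  have hSm : Measurable S := hHc.measurable.enorm.lintegral_prod_right'
  have hS : ∀ X : ℝ, ‖∫ s in y..Y, h (X + s * Complex.I)‖ₑ ≤ S X := by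
    intro X
    rw [intervalIntegral.integral_of_le hY.le]
    refine (enorm_integral_le_lintegral_enorm _).trans
      (setLIntegral_mono' measurableSet_Ioc fun s hs => ?_)
    simp only [H, max_eq_left hs.1.le]
    exact le_rfl
  have hSfin : ∫⁻ X, S X ≠ ∞ := by
    have e : ∫⁻ X, S X = ∫⁻ s in Set.Ioc y Y, ∫⁻ X, ‖H (X, s)‖ₑ :=
      lintegral_lintegral_swap hHc.measurable.enorm.aemeasurable
    rw [e]
    refine ne_top_of_le_ne_top (b := ∫⁻ _ in Set.Ioc y Y, K) ?_
      (lintegral_mono fun s => hK _ (lt_max_of_lt_right hy))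
    simp only [lintegral_const, Measure.restrict_apply MeasurableSet.univ, Set.univ_inter,
      Real.volume_Ioc]
    exact ENNReal.mul_ne_top hKfin ENNReal.ofReal_ne_top
  have hch : ∀ n : ℕ, ∃ X : ℝ, (n : ℝ) ≤ X ∧ S X + S (-X) < ((n : ℝ≥0∞) + 1)⁻¹ := fun n =>
    exists_ge_lt_of_lintegral_ne_top hSm hSfin n (by simp)
  choose X hX1 hX2 using hch
  have hXtop : Tendsto X atTop atTop :=
    tendsto_atTop_mono hX1 tendsto_natCast_atTop_atTop
  have hlim := (continuous_enorm.tendsto _).comp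
    (intervalIntegral_tendsto_integral hint (tendsto_neg_atTop_atBot.comp hXtop) hXtop)
  have hrhs : Tendsto (fun n : ℕ => (∫⁻ x : ℝ, ‖h (x + Y * Complex.I)‖ₑ) + ((n : ℝ≥0∞) + 1)⁻¹)
      atTop (𝓝 ((∫⁻ x : ℝ, ‖h (x + Y * Complex.I)‖ₑ) + 0)) := by
    refine tendsto_const_nhds.add ?_
    have := (tendsto_add_atTop_iff_nat 1).2 ENNReal.tendsto_inv_nat_nhds_zero
    simpa using this
  rw [add_zero] at hrhs
  refine le_of_tendsto_of_tendsto' hlim hrhs fun n => ?_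
  have hn : (0 : ℝ) ≤ X n := (Nat.cast_nonneg n).trans (hX1 n)
  have hrect := Complex.integral_boundary_rect_eq_zero_of_differentiableOn h
    (((-X n : ℝ) : ℂ) + y * Complex.I) (((X n : ℝ) : ℂ) + Y * Complex.I) (by
      refine hhd.mono fun z hz => ?_
      have := hz.2
      simp [Set.uIcc_of_le hY.le] at this
      exact hy.trans_le this.1)
  simp only [Complex.add_re, Complex.ofReal_re, Complex.mul_re, Complex.I_re, mul_zero,
    Complex.ofReal_im, Complex.I_im, mul_one, sub_self, add_zero, Complex.add_im,
    Complex.mul_im, zero_add, smul_eq_mul] at hrect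
  have e : ∫ x in (-X n)..X n, h (x + y * Complex.I) =
      (∫ x in (-X n)..X n, h (x + Y * Complex.I)) -
        Complex.I * (∫ s in y..Y, h ((X n : ℝ) + s * Complex.I)) +
        Complex.I * (∫ s in y..Y, h ((-X n : ℝ) + s * Complex.I)) := by
    linear_combination hrect
  have h1 : ‖∫ x in (-X n)..X n, h (x + Y * Complex.I)‖ₑ ≤
      ∫⁻ x : ℝ, ‖h (x + Y * Complex.I)‖ₑ := by
    rw [intervalIntegral.integral_of_le (by linarith)]
    exact (enorm_integral_le_lintegral_enorm _).trans (setLIntegral_le_lintegral _ _)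
  show ‖∫ x in (-X n)..X n, h (x + y * Complex.I)‖ₑ ≤ _
  rw [e]
  refine (enorm_add_le _ _).trans ((add_le_add_left (enorm_sub_le) _).trans ?_)
  rw [enorm_mul, enorm_mul, add_assoc]
  have hI : ‖Complex.I‖ₑ = 1 := by simp [enorm, nnnorm]
  rw [hI, one_mul, one_mul]
  exact add_le_add h1 ((add_le_add (hS _) (hS _)).trans (hX2 n).le)

-- The integral is bounded by the L¹-norm on any higher line, and those norms tend to 0 at great
-- height.
open DeBranges in
theorem integral_horizontal_mul_inv_sub_conj_eq_zero {f : ℂ → ℂ} (hf : f ∈ HardyTwo) {w : ℂ}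
    (hw : 0 < w.im) {y : ℝ} (hy : 0 < y) :
    ∫ x : ℝ, f (x + y * Complex.I) * ((x : ℂ) + y * Complex.I - conj w)⁻¹ = 0 := by
  obtain ⟨hfd, C, hC⟩ := hf
  let h : ℂ → ℂ := fun z => f z * (z - conj w)⁻¹
  have hhd : DifferentiableOn ℂ h {z : ℂ | 0 < z.im} := by
    refine hfd.mul (DifferentiableOn.inv (by fun_prop) fun z hz => ?_)
    have := add_mul_I_sub_conj_ne_zero hw z.re (le_of_lt hz)
    rwa [Complex.re_add_im] at this
  show ∫ x : ℝ, h (x + y * Complex.I) = 0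
  have hN : ∀ s : ℝ, 0 < s → ∫⁻ x : ℝ, ‖h (x + s * Complex.I)‖ₑ ≤ (NNReal.sqrt C : ℝ≥0) *
      eLpNorm (fun x : ℝ => ((x : ℂ) + s * Complex.I - conj w)⁻¹) 2 volume := fun s hs =>
    lintegral_mul_inv_sub_conj_le hfd hw hs (hC s hs)
  obtain ⟨K, hK⟩ : ∃ K : ℝ≥0∞, K ≠ ∞ ∧ ∀ s : ℝ, 0 < s →
      ∫⁻ x : ℝ, ‖h (x + s * Complex.I)‖ₑ ≤ K := by
    refine ⟨_, ENNReal.mul_ne_top (ENNReal.coe_ne_top (r := NNReal.sqrt C)) (memLp_inv_sub_conj hw le_rfl).2.ne,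
      fun s hs => (hN s hs).trans ?_⟩
    gcongr
    refine eLpNorm_mono fun x => ?_
    simpa using norm_inv_sub_conj_le hw x hs.le
  have key : ∀ Y : ℝ, y < Y →
      ‖∫ x : ℝ, h (x + y * Complex.I)‖ₑ ≤ ∫⁻ x : ℝ, ‖h (x + Y * Complex.I)‖ₑ := fun Y hY =>
    enorm_integral_horizontal_le hhd hK.1 hK.2 hy hY
  have hzero : ‖∫ x : ℝ, h (x + y * Complex.I)‖ₑ ≤ 0 := by
    have ht := ENNReal.Tendsto.const_mul (a := ((NNReal.sqrt C : ℝ≥0) : ℝ≥0∞))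
      (tendsto_eLpNorm_inv_sub_conj hw) (Or.inr ENNReal.coe_ne_top)
    rw [mul_zero] at ht
    refine ge_of_tendsto ht ?_
    filter_upwards [eventually_gt_atTop ⌈y⌉₊] with n hn
    have hyn : y < n := Nat.lt_of_ceil_lt hn
    exact (key n hyn).trans (hN n (hy.trans hyn))
  simpa using hzero

open DeBranges in
/-- Cauchy's theorem for the boundary function of an element of the Hardy space. -/
theorem integrable_and_integral_boundary_eq_zero {f : ℂ → ℂ} (hf : f ∈ HardyTwo) {b : ℝ → ℂ}
    (hb : ∀ᵐ t : ℝ, Tendsto (fun y : ℝ => f (t + y * Complex.I)) (𝓝[>] 0) (𝓝 (b t))) {w : ℂ}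
    (hw : 0 < w.im) :
    Integrable (fun t : ℝ => b t * ((t : ℂ) - conj w)⁻¹) ∧
      ∫ t : ℝ, b t * ((t : ℂ) - conj w)⁻¹ = 0 := by
  obtain ⟨hfd, C, hC⟩ := hf
  have hmem0 := memLp_inv_sub_conj hw le_rfl
  simp only [Complex.ofReal_zero, zero_mul, add_zero] at hmem0
  let y : ℕ → ℝ := fun n => 1 / ((n : ℝ) + 1)
  have hy : ∀ n, 0 < y n := fun n => by positivity
  have hy0 : Tendsto y atTop (𝓝[>] 0) := tendsto_nhdsWithin_iff.2
    ⟨tendsto_one_div_add_atTop_nhds_zero_nat, Eventually.of_forall hy⟩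
  let F : ℕ → ℝ → ℂ := fun n x => f (x + y n * Complex.I)
  have hFm : ∀ n, AEStronglyMeasurable (F n) volume := fun n =>
    (continuous_horizontal hfd (hy n)).aestronglyMeasurable
  have hFC : ∀ n, eLpNorm (F n) 2 volume ≤ (NNReal.sqrt C : ℝ≥0) := fun n =>
    eLpNorm_two_le_of_lintegral_le (hC _ (hy n))
  have hFb : ∀ᵐ t : ℝ, Tendsto (fun n => F n t) atTop (𝓝 (b t)) := by
    filter_upwards [hb] with t ht
    exact ht.comp hy0
  -- Fatou's lemma: the slices at heights 1/(n+1) are bounded in L².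
  have hbmem : MemLp b 2 volume := by
    refine ⟨aestronglyMeasurable_of_tendsto_ae atTop hFm hFb, ?_⟩
    refine (Lp.eLpNorm_lim_le_liminf_eLpNorm hFm b hFb).trans_lt
      (lt_of_le_of_lt ?_ (ENNReal.coe_lt_top (r := NNReal.sqrt C)))
    exact liminf_le_of_le (by isBoundedDefault) fun c hc => by
      obtain ⟨n, hn⟩ := hc.exists
      exact hn.trans (hFC n)
  refine ⟨hbmem.integrable_mul hmem0, ?_⟩
  have hlim := tendsto_integral_mul_of_eLpNorm_two_le hFm
    (g := fun n (x : ℝ) => ((x : ℂ) + y n * Complex.I - conj w)⁻¹)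
    (h := fun t : ℝ => b t * ((t : ℂ) - conj w)⁻¹)
    (fun n => (memLp_inv_sub_conj hw (hy n).le).1) hFC hmem0
    (fun n x => norm_inv_sub_conj_le hw x (hy n).le) (by
      filter_upwards [hFb] with t ht
      refine ht.mul ?_
      have h0 := add_mul_I_sub_conj_ne_zero hw t le_rfl
      simp only [Complex.ofReal_zero, zero_mul, add_zero] at h0
      have : Tendsto (fun n => (t : ℂ) + y n * Complex.I - conj w) atTop
          (𝓝 ((t : ℂ) + (0 : ℝ) * Complex.I - conj w)) :=
        (Continuous.tendsto (f := fun s : ℝ => (t : ℂ) + s * Complex.I - conj w)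
          (by fun_prop) 0).comp (tendsto_nhdsWithin_iff.1 hy0).1
      simp only [Complex.ofReal_zero, zero_mul, add_zero] at this
      exact this.inv₀ h0)
  refine tendsto_nhds_unique hlim ?_
  refine tendsto_const_nhds.congr fun n => ?_
  exact (integral_horizontal_mul_inv_sub_conj_eq_zero ⟨hfd, C, hC⟩ hw (hy n)).symm

end

namespace DeBranges

/-! ### The reproducing kernel of a de Branges space -/

section Kernel

variable {H : Type*} [NormedAddCommGroup H] [InnerProductSpace ℂ H] [RKHS ℂ H ℂ ℂ]

/-- In a de Branges space, point evaluations in the upper half-plane are controlled by the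
kernel function at the point `i`. -/
theorem IsDeBrangesSpace.sq_norm_apply_le [CompleteSpace H] (hH : IsDeBrangesSpace H) (F : H)
    {z : ℂ} (hz : 0 < z.im) :
    4 * z.im * (‖RKHS.kerFun H Complex.I (1 : ℂ)‖ ^ 2 * ‖F z‖ ^ 2) ≤
      ‖z + Complex.I‖ ^ 2 * ‖RKHS.kerFun H Complex.I (1 : ℂ) z‖ ^ 2 * ‖F‖ ^ 2 := by
  set k : H := RKHS.kerFun H Complex.I (1 : ℂ) with hk
  set kz : H := RKHS.kerFun H z (1 : ℂ) with hkz
  have hk_inner : ∀ X : H, inner ℂ k X = X Complex.I := fun X => by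
    simp [hk]
  have hkz_inner : ∀ X : H, inner ℂ kz X = X z := fun X => by
    simp [hkz]
  have hkz_le : ∀ X : H, ‖X z‖ ≤ ‖kz‖ * ‖X‖ := fun X => by
    rw [← hkz_inner]; exact norm_inner_le_norm _ _
  rcases eq_or_ne k 0 with h0 | h0
  · rw [h0]
    simp
  have hkn : 0 < ‖k‖ := norm_pos_iff.2 h0
  have hkc : ((‖k‖ : ℝ) : ℂ) ≠ 0 := by exact_mod_cast hkn.ne'
  set c : ℂ := kz Complex.I / (‖k‖ : ℂ) ^ 2 with hc
  -- The component of the kernel at z orthogonal to k; it vanishes at i, so its zero there can be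
  -- divided out isometrically.
  set k0 : H := kz - c • k with hk0
  have hkk : k Complex.I = (‖k‖ : ℂ) ^ 2 := by
    rw [← hk_inner, inner_self_eq_norm_sq_to_K]; rfl
  have hk0I : k0 Complex.I = 0 := by
    rw [hk0, RKHS.coe_sub, RKHS.coe_smul, Pi.sub_apply, Pi.smul_apply, smul_eq_mul, hkk, hc,
      div_mul_cancel₀ _ (pow_ne_zero 2 hkc), sub_self]
  have horth : inner ℂ k k0 = 0 := by rw [hk_inner, hk0I]
  have hk0z : k0 z = (‖k0‖ : ℂ) ^ 2 := by
    have e : kz = k0 + c • k := by rw [hk0]; abel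
    rw [← hkz_inner, e, inner_add_left, inner_smul_left, horth, mul_zero, add_zero,
      inner_self_eq_norm_sq_to_K]
    rfl
  have hnorm : ‖kz‖ ^ 2 = ‖k0‖ ^ 2 + ‖c‖ ^ 2 * ‖k‖ ^ 2 := by
    have e : kz = k0 + c • k := by rw [hk0]; abel
    have ho : inner ℂ k0 (c • k) = 0 := by
      rw [inner_smul_right, inner_eq_zero_symm.1 horth, mul_zero]
    have := norm_add_sq_eq_norm_sq_add_norm_sq_of_inner_eq_zero k0 (c • k) ho
    rw [← e, norm_smul] at this
    nlinarith
  have hcn : ‖c‖ ^ 2 * ‖k‖ ^ 2 * ‖k‖ ^ 2 = ‖k z‖ ^ 2 := by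
    have h1 : ‖kz Complex.I‖ = ‖k z‖ := by
      rw [← hk_inner, ← hkz_inner, ← inner_conj_symm, RCLike.norm_conj]
    rw [hc, norm_div, norm_pow, Complex.norm_real, norm_norm, h1]
    field_simp
  -- X = (z+i)/(z-i) · k0 has norm ‖k0‖ and k0(z) = ‖k0‖², so the bound |X(z)| ≤ ‖kz‖‖X‖ yields the
  -- claim after cancelling ‖k0‖.
  have hmain : ‖z + Complex.I‖ ^ 2 * ‖k0‖ ^ 2 ≤ ‖z - Complex.I‖ ^ 2 * ‖kz‖ ^ 2 := by
    rcases eq_or_ne z Complex.I with rfl | hzI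
    · have : k0 = 0 := by
        rw [← norm_eq_zero]
        have := hk0z.symm.trans hk0I
        exact_mod_cast pow_eq_zero_iff two_ne_zero |>.1 this
      rw [this]
      simp
    obtain ⟨X, hX, hXn⟩ := hH.div_mem Complex.I k0 (by simp) hk0I
    have hXz := hX z hzI
    have h1 := hkz_le X
    have hzI' : 0 < ‖z - Complex.I‖ := norm_pos_iff.2 (sub_ne_zero.2 hzI)
    rw [hXz, hXn, hk0z, norm_mul, norm_div, Complex.conj_I, sub_neg_eq_add, norm_pow,
      Complex.norm_real, norm_norm, div_mul_eq_mul_div, div_le_iff₀ hzI'] at h1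
    rcases (norm_nonneg k0).eq_or_lt with h2 | h2
    · rw [← h2]
      simp
      positivity
    have h3 : ‖z + Complex.I‖ * ‖k0‖ ≤ ‖z - Complex.I‖ * ‖kz‖ := by
      apply le_of_mul_le_mul_right _ h2
      nlinarith
    have := pow_le_pow_left₀ (by positivity) h3 2
    rwa [mul_pow, mul_pow] at this
  have hsq : ‖z + Complex.I‖ ^ 2 - ‖z - Complex.I‖ ^ 2 = 4 * z.im := by
    rw [Complex.sq_norm, Complex.sq_norm, Complex.normSq_apply, Complex.normSq_apply]
    simp
    ring
  have hdiag : 4 * z.im * (‖k‖ ^ 2 * ‖kz‖ ^ 2) ≤ ‖z + Complex.I‖ ^ 2 * ‖k z‖ ^ 2 := by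
    have h4 : ‖k0‖ ^ 2 * ‖k‖ ^ 2 = ‖kz‖ ^ 2 * ‖k‖ ^ 2 - ‖k z‖ ^ 2 := by
      rw [hnorm, ← hcn]; ring
    have h5 := mul_le_mul_of_nonneg_right hmain (sq_nonneg ‖k‖)
    rw [mul_assoc, h4] at h5
    rw [← hsq]
    nlinarith
  calc 4 * z.im * (‖k‖ ^ 2 * ‖F z‖ ^ 2) ≤ 4 * z.im * (‖k‖ ^ 2 * (‖kz‖ * ‖F‖) ^ 2) := by
        gcongr
        exact hkz_le F
    _ = 4 * z.im * (‖k‖ ^ 2 * ‖kz‖ ^ 2) * ‖F‖ ^ 2 := by ring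
    _ ≤ _ := by gcongr

end Kernel

/-! ### Hermite-Biehler functions -/

section HermiteBiehler

variable {E : ℂ → ℂ}

theorem differentiable_sharp {F : ℂ → ℂ} (hF : Differentiable ℂ F) : Differentiable ℂ (sharp F) :=
  fun z => (differentiableAt_conj_conj_iff (f := F) (x := z)).2 (hF _)

theorem norm_sharp_ofReal (F : ℂ → ℂ) (t : ℝ) : ‖sharp F t‖ = ‖F t‖ := by
  simp [sharp]

theorem ne_zero_of_im_pos (hE : E ∈ HermiteBiehler) {z : ℂ} (hz : 0 < z.im) : E z ≠ 0 :=
  norm_pos_iff.1 ((norm_nonneg _).trans_lt (hE.2 z hz))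

theorem norm_sharp_le (hE : E ∈ HermiteBiehler) {z : ℂ} (hz : 0 ≤ z.im) :
    ‖sharp E z‖ ≤ ‖E z‖ := by
  rcases hz.eq_or_lt with h | h
  · have : z = z.re := by apply Complex.ext <;> simp [← h]
    rw [this, norm_sharp_ofReal]
  · exact (hE.2 z h).le

theorem majorant_eq (hE : E ∈ HermiteBiehler) {z : ℂ} (hz : 0 ≤ z.im) :
    majorant E z = ‖E z‖ / ‖z + Complex.I‖ := by
  rw [majorant, max_eq_left (norm_sharp_le hE hz)]

theorem norm_add_I_pos {z : ℂ} (hz : 0 ≤ z.im) : 0 < ‖z + Complex.I‖ := by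
  refine norm_pos_iff.2 fun h => ?_
  have := congrArg Complex.im h
  simp at this
  linarith

-- The zeros of an entire function that is not identically zero are discrete, hence countable. `E`
-- may vanish at real points, so boundary quotients by `E` are only handled almost everywhere.
open MeasureTheory in
theorem ae_ne_zero (hE : E ∈ HermiteBiehler) : ∀ᵐ t : ℝ, E t ≠ 0 := by
  have han : AnalyticOnNhd ℂ E Set.univ := fun z _ => hE.1.analyticAt z
  have hcod := han.preimage_zero_mem_codiscrete (x := Complex.I)
    (ne_zero_of_im_pos hE (by simp))
  have hdisc : IsDiscrete ((E ⁻¹' {0}ᶜ)ᶜ ∩ Set.univ) :=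
    isDiscrete_of_codiscreteWithin (by rwa [compl_compl])
  have hcount : ((E ⁻¹' {0}ᶜ)ᶜ ∩ Set.univ).Countable := by
    have := isDiscrete_iff_discreteTopology.mp hdisc
    exact TopologicalSpace.separableSpace_iff_countable.1 inferInstance
  have hpre := (hcount.preimage Complex.ofReal_injective).measure_zero volume
  rw [ae_iff]
  convert hpre using 2
  ext t
  simp

/-- On every horizontal line in the upper half-plane |z+i|² ≥ x² + 1, which is why the majorant
carries the weight 1/|z+i|. -/
theorem mem_hardyTwo_of_norm_le {f : ℂ → ℂ} {C : ℝ}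
    (hf : DifferentiableOn ℂ f {z : ℂ | 0 < z.im})
    (hC : ∀ z : ℂ, 0 < z.im → ‖f z‖ ≤ C / ‖z + Complex.I‖) : f ∈ HardyTwo := by
  have hfin : (∫⁻ x : ℝ, ENNReal.ofReal (C ^ 2 * ((x - 0) ^ 2 + 1 ^ 2)⁻¹)) < ∞ :=
    ((integrable_inv_sq_add_sq 0 one_pos).const_mul (C ^ 2)).lintegral_lt_top
  refine ⟨hf, (∫⁻ x : ℝ, ENNReal.ofReal (C ^ 2 * ((x - 0) ^ 2 + 1 ^ 2)⁻¹)).toNNReal,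
    fun y hy => ?_⟩
  rw [ENNReal.coe_toNNReal hfin.ne]
  refine MeasureTheory.lintegral_mono fun x => ?_
  have him : ((x : ℂ) + y * Complex.I).im = y := by simp
  have h := hC (x + y * Complex.I) (by rw [him]; exact hy)
  rw [← ofReal_norm, ← ENNReal.ofReal_pow (norm_nonneg _)]
  apply ENNReal.ofReal_le_ofReal
  have hn := sq_norm_add_mul_I_sub_conj Complex.I x y
  simp only [Complex.conj_I, sub_neg_eq_add, Complex.I_re, Complex.I_im] at hn
  calc ‖f (x + y * Complex.I)‖ ^ 2 ≤ (C / ‖(x : ℂ) + y * Complex.I + Complex.I‖) ^ 2 := by gcongr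
    _ = C ^ 2 * ((x - 0) ^ 2 + (y + 1) ^ 2)⁻¹ := by rw [div_pow, hn, div_eq_mul_inv]
    _ ≤ C ^ 2 * ((x - 0) ^ 2 + 1 ^ 2)⁻¹ := by
      gcongr
      linarith

theorem mem_spaceOf_of_norm_le (hE : E ∈ HermiteBiehler) {F : ℂ → ℂ} {C : ℝ}
    (hF : Differentiable ℂ F)
    (hC : ∀ z : ℂ, 0 < z.im → ‖F z‖ ≤ C * (‖E z‖ / ‖z + Complex.I‖))
    (hC' : ∀ z : ℂ, 0 < z.im → ‖sharp F z‖ ≤ C * (‖E z‖ / ‖z + Complex.I‖)) : F ∈ spaceOf E := by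
  have key : ∀ X : ℂ → ℂ, Differentiable ℂ X →
      (∀ z : ℂ, 0 < z.im → ‖X z‖ ≤ C * (‖E z‖ / ‖z + Complex.I‖)) →
      (fun z => X z / E z) ∈ HardyTwo := by
    intro X hX hXC
    refine mem_hardyTwo_of_norm_le (C := C)
      (hX.differentiableOn.div hE.1.differentiableOn fun z hz => ne_zero_of_im_pos hE hz)
      fun z hz => ?_
    have hEz : 0 < ‖E z‖ := norm_pos_iff.2 (ne_zero_of_im_pos hE hz)
    rw [norm_div, div_le_iff₀ hEz]
    refine (hXC z hz).trans (le_of_eq ?_)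
    ring
  exact ⟨hF, key F hF hC, key _ (differentiable_sharp hF) hC'⟩

/-- The numerator of the reproducing kernel of `H(E)`. -/
def kernelNumerator (E : ℂ → ℂ) (w : ℂ) : ℂ → ℂ := fun z =>
  E z * conj (E w) - sharp E z * conj (sharp E w)

/-- The reproducing kernel of `H(E)` at `w`, up to a constant factor. -/
noncomputable def kernelFun (E : ℂ → ℂ) (w : ℂ) : ℂ → ℂ := dslope (kernelNumerator E w) (conj w)

theorem kernelNumerator_conj (w : ℂ) : kernelNumerator E w (conj w) = 0 := by
  simp [kernelNumerator, sharp, mul_comm]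

theorem sub_mul_kernelFun (w z : ℂ) : (z - conj w) * kernelFun E w z = kernelNumerator E w z := by
  have := sub_smul_dslope (kernelNumerator E w) (conj w) z
  rwa [kernelNumerator_conj, sub_zero, smul_eq_mul] at this

theorem differentiable_kernelFun (hE : Differentiable ℂ E) (w : ℂ) :
    Differentiable ℂ (kernelFun E w) := by
  have hs := differentiable_sharp hE
  have hN : Differentiable ℂ (kernelNumerator E w) :=
    (hE.mul_const _).sub (hs.mul_const _)
  rw [← differentiableOn_univ] at hN ⊢
  exact (Complex.differentiableOn_dslope Filter.univ_mem).2 hN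

theorem sub_mul_sharp_kernelFun (w z : ℂ) :
    (z - w) * sharp (kernelFun E w) z = sharp E z * E w - E z * sharp E w := by
  have h := congrArg conj (sub_mul_kernelFun (E := E) w (conj z))
  simp only [map_mul, map_sub, Complex.conj_conj, kernelNumerator] at h
  rw [sharp, h]
  simp [sharp]

theorem norm_sub_conj_pos {w z : ℂ} (hw : 0 < w.im) (hz : 0 ≤ z.im) : 0 < ‖z - conj w‖ := by
  refine norm_pos_iff.2 fun h => ?_
  have := congrArg Complex.im h
  simp at this
  linarith

theorem im_le_norm_sub_conj {w z : ℂ} (hz : 0 ≤ z.im) : w.im ≤ ‖z - conj w‖ := by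
  refine le_trans ?_ ((le_abs_self _).trans (Complex.abs_im_le_norm _))
  simp
  exact hz

/-- Both numerators are at most 2|E(w)||E(z)|, and |z - conj w| dominates a multiple of |z+i|. For
the reflected function the denominator z - w vanishes inside the half-plane; near w compactness
takes over. -/
theorem exists_norm_kernelFun_le (hE : E ∈ HermiteBiehler) {w : ℂ} (hw : 0 < w.im) :
    ∃ C : ℝ, 0 < C ∧ ∀ z : ℂ, 0 ≤ z.im →
      ‖kernelFun E w z‖ ≤ C * (‖E z‖ / ‖z + Complex.I‖) ∧
      ‖sharp (kernelFun E w) z‖ ≤ C * (‖E z‖ / ‖z + Complex.I‖) := by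
  have hEw : 0 < ‖E w‖ := norm_pos_iff.2 (ne_zero_of_im_pos hE hw)
  have aux : ∀ (a z X : ℂ) (r : ℝ), 0 < r → 0 ≤ z.im → r ≤ ‖z - a‖ →
      ‖(z - a) * X‖ ≤ 2 * ‖E w‖ * ‖E z‖ →
      ‖X‖ ≤ 2 * ‖E w‖ * (1 + ‖a + Complex.I‖ / r) * (‖E z‖ / ‖z + Complex.I‖) := by
    intro a z X r hr hz hza hX
    have hzi := norm_add_I_pos hz
    have h1 : ‖z + Complex.I‖ ≤ ‖z - a‖ * (1 + ‖a + Complex.I‖ / r) := by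
      have h2 : ‖z + Complex.I‖ ≤ ‖z - a‖ + ‖a + Complex.I‖ := by
        have : z + Complex.I = (z - a) + (a + Complex.I) := by ring
        rw [this]
        exact norm_add_le _ _
      have h3 : ‖a + Complex.I‖ ≤ ‖z - a‖ * (‖a + Complex.I‖ / r) := by
        rw [mul_div_assoc', le_div_iff₀ hr, mul_comm]
        gcongr
      linarith
    rw [mul_div_assoc', le_div_iff₀ hzi]
    rw [norm_mul] at hX
    calc ‖X‖ * ‖z + Complex.I‖ ≤ ‖X‖ * (‖z - a‖ * (1 + ‖a + Complex.I‖ / r)) := by gcongr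
      _ = ‖z - a‖ * ‖X‖ * (1 + ‖a + Complex.I‖ / r) := by ring
      _ ≤ 2 * ‖E w‖ * ‖E z‖ * (1 + ‖a + Complex.I‖ / r) := by gcongr
      _ = _ := by ring
  have hsw := norm_sharp_le hE hw.le
  -- The ball of radius Im w / 2 stays in the open half-plane, where `E` has no zeros.
  obtain ⟨C₁, hC₁⟩ : ∃ C₁ : ℝ, ∀ z ∈ Metric.closedBall w (w.im / 2),
      ‖sharp (kernelFun E w) z * (z + Complex.I) / E z‖ ≤ C₁ := by
    refine (isCompact_closedBall _ _).exists_bound_of_continuousOn ?_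
    refine ContinuousOn.div ?_ hE.1.continuous.continuousOn fun z hz => ?_
    · have := (differentiable_sharp (differentiable_kernelFun hE.1 w)).continuous
      fun_prop
    · apply ne_zero_of_im_pos hE
      rw [Metric.mem_closedBall, dist_eq_norm] at hz
      have h2 := (abs_le.1 ((Complex.abs_im_le_norm (z - w)).trans hz)).1
      rw [Complex.sub_im] at h2
      linarith
  refine ⟨2 * ‖E w‖ * (1 + ‖conj w + Complex.I‖ / w.im) +
    2 * ‖E w‖ * (1 + ‖w + Complex.I‖ / (w.im / 2)) + |C₁|, by positivity, fun z hz => ?_⟩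
  have hsz := norm_sharp_le hE hz
  have hzi := norm_add_I_pos hz
  have hq : 0 ≤ ‖E z‖ / ‖z + Complex.I‖ := by positivity
  have hA : 0 ≤ 2 * ‖E w‖ * (1 + ‖conj w + Complex.I‖ / w.im) := by positivity
  have hB : 0 ≤ 2 * ‖E w‖ * (1 + ‖w + Complex.I‖ / (w.im / 2)) := by positivity
  have hD := abs_nonneg C₁
  constructor
  · have h := aux (conj w) z (kernelFun E w z) w.im hw hz (im_le_norm_sub_conj hz) (by
      rw [sub_mul_kernelFun, kernelNumerator]
      refine (norm_sub_le _ _).trans ?_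
      rw [norm_mul, norm_mul, RCLike.norm_conj, RCLike.norm_conj]
      have := mul_le_mul hsz hsw (norm_nonneg _) (norm_nonneg _)
      linarith)
    refine h.trans ?_
    gcongr
    linarith
  · rcases le_total (w.im / 2) ‖z - w‖ with hzw | hzw
    · have h := aux w z (sharp (kernelFun E w) z) (w.im / 2) (by linarith) hz hzw (by
        rw [sub_mul_sharp_kernelFun]
        refine (norm_sub_le _ _).trans ?_
        rw [norm_mul, norm_mul]
        have h1 := mul_le_mul_of_nonneg_right hsz (norm_nonneg (E w))
        have h2 := mul_le_mul_of_nonneg_left hsw (norm_nonneg (E z))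
        linarith)
      refine h.trans ?_
      gcongr
      linarith
    · have h := hC₁ z (by rwa [Metric.mem_closedBall, dist_eq_norm])
      have hzim : 0 < z.im := by
        have h2 := (abs_le.1 ((Complex.abs_im_le_norm (z - w)).trans hzw)).1
        rw [Complex.sub_im] at h2
        linarith
      have hEz : 0 < ‖E z‖ := norm_pos_iff.2 (ne_zero_of_im_pos hE hzim)
      rw [norm_div, norm_mul, div_le_iff₀ hEz] at h
      have h1 : ‖sharp (kernelFun E w) z‖ ≤ C₁ * (‖E z‖ / ‖z + Complex.I‖) := by
        rw [mul_div_assoc', le_div_iff₀ hzi]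
        exact h
      refine h1.trans ?_
      gcongr
      have := le_abs_self C₁
      linarith

/-- The numerator is at least |E(z)|(|E(w)| - |E^#(w)|), and the gap is positive by the
Hermite-Biehler inequality at w. Thus the kernel function, unlike `E` a member of the space, can
serve as denominator. -/
theorem exists_le_norm_kernelFun (hE : E ∈ HermiteBiehler) {w : ℂ} (hw : 0 < w.im) :
    ∃ c : ℝ, 0 < c ∧ ∀ z : ℂ, 0 ≤ z.im →
      ‖E z‖ / ‖z + Complex.I‖ ≤ c * ‖kernelFun E w z‖ := by
  have hgap : 0 < ‖E w‖ - ‖sharp E w‖ := sub_pos.2 (hE.2 w hw)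
  refine ⟨(1 + ‖conj w + Complex.I‖) / (‖E w‖ - ‖sharp E w‖), by positivity, fun z hz => ?_⟩
  have hzi := norm_add_I_pos hz
  have h0 := norm_sub_conj_pos hw hz
  have hlow : ‖E z‖ * (‖E w‖ - ‖sharp E w‖) ≤ ‖z - conj w‖ * ‖kernelFun E w z‖ := by
    rw [← norm_mul, sub_mul_kernelFun, kernelNumerator]
    refine le_trans ?_ (norm_sub_norm_le _ _)
    rw [norm_mul, norm_mul, RCLike.norm_conj, RCLike.norm_conj]
    have := mul_le_mul_of_nonneg_right (norm_sharp_le hE hz) (norm_nonneg (sharp E w))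
    linarith
  have hup : ‖z - conj w‖ ≤ ‖z + Complex.I‖ * (1 + ‖conj w + Complex.I‖) := by
    have h2 : ‖z - conj w‖ ≤ ‖z + Complex.I‖ + ‖conj w + Complex.I‖ := by
      have : z - conj w = (z + Complex.I) - (conj w + Complex.I) := by ring
      rw [this]
      exact norm_sub_le _ _
    have h3 : 1 ≤ ‖z + Complex.I‖ := by
      refine le_trans ?_ ((le_abs_self _).trans (Complex.abs_im_le_norm _))
      simp
      exact hz
    nlinarith [norm_nonneg (conj w + Complex.I)]
  rw [div_le_iff₀ hzi, div_mul_eq_mul_div, div_mul_eq_mul_div, le_div_iff₀ hgap]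
  refine hlow.trans ?_
  have := mul_le_mul_of_nonneg_right hup (norm_nonneg (kernelFun E w z))
  linarith

theorem kernelFun_mem_spaceOf (hE : E ∈ HermiteBiehler) {w : ℂ} (hw : 0 < w.im) :
    kernelFun E w ∈ spaceOf E := by
  obtain ⟨C, -, hC⟩ := exists_norm_kernelFun_le hE hw
  exact mem_spaceOf_of_norm_le hE (differentiable_kernelFun hE.1 w)
    (fun z hz => (hC z hz.le).1) fun z hz => (hC z hz.le).2

theorem kernelFun_ne_zero (hE : E ∈ HermiteBiehler) {w z : ℂ} (hw : 0 < w.im) (hz : 0 < z.im) :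
    kernelFun E w z ≠ 0 := by
  obtain ⟨c, hc, h⟩ := exists_le_norm_kernelFun hE hw
  have h1 := h z hz.le
  have h2 : 0 < ‖E z‖ / ‖z + Complex.I‖ :=
    div_pos (norm_pos_iff.2 (ne_zero_of_im_pos hE hz)) (norm_add_I_pos hz.le)
  intro h0
  rw [h0, norm_zero, mul_zero] at h1
  linarith

end HermiteBiehler

end DeBranges

namespace DeBranges

/-! ### Density of the kernel functions -/

section Density

variable {K : Type*} [NormedAddCommGroup K] [InnerProductSpace ℂ K] [RKHS ℂ K ℂ ℂ] {E : ℂ → ℂ}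

theorem EqSpaceOf.mem (hK : EqSpaceOf K E) (F : K) : (F : ℂ → ℂ) ∈ spaceOf E := by
  rw [← hK.range_eq]
  exact ⟨F, rfl⟩

open Filter Topology in
theorem tendsto_div_boundary {F E : ℂ → ℂ} (hF : Differentiable ℂ F) (hE : Differentiable ℂ E)
    {t : ℝ} (ht : E t ≠ 0) :
    Tendsto (fun y : ℝ => F (t + y * Complex.I) / E (t + y * Complex.I)) (𝓝[>] 0)
      (𝓝 (F t / E t)) := by
  have hc : ContinuousAt (fun z => F z / E z) (t : ℂ) :=
    hF.continuous.continuousAt.div hE.continuous.continuousAt ht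
  have hl : Tendsto (fun y : ℝ => (t : ℂ) + y * Complex.I) (𝓝[>] 0) (𝓝 (t : ℂ)) :=
    tendsto_nhdsWithin_of_tendsto_nhds
      ((Continuous.tendsto' (by fun_prop) 0 (t : ℂ) (by simp)))
  exact hc.tendsto.comp hl

/-- With T = Y (z - conj w)/(z - w) and S = Y^#, the integrand on the real line is E(w) (T/E)/(t -
conj w) minus E^#(w) times the conjugate of (S/E)/(t - conj w). Both T/E and S/E lie in H², so
Cauchy's theorem annihilates each term. -/
theorem EqSpaceOf.inner_kernelFun_eq_zero (hdB : IsDeBrangesSpace K) (hK : EqSpaceOf K E)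
    {w : ℂ} (hw : 0 < w.im) {G Y : K} (hG : (G : ℂ → ℂ) = kernelFun E w) (hY : Y w = 0) :
    inner ℂ G Y = 0 := by
  have hE := hK.hermiteBiehler
  obtain ⟨T, hT, -⟩ := hdB.div_mem w Y hw.ne' hY
  obtain ⟨S, hS, -⟩ := hdB.sharp_mem Y
  obtain ⟨hT1, hT2⟩ := integrable_and_integral_boundary_eq_zero (hK.mem T).2.1
    (b := fun t : ℝ => T t / E t)
    ((ae_ne_zero hE).mono fun t ht => tendsto_div_boundary (hdB.entire T) hE.1 ht) hw
  obtain ⟨hS1, hS2⟩ := integrable_and_integral_boundary_eq_zero (hK.mem S).2.1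
    (b := fun t : ℝ => S t / E t)
    ((ae_ne_zero hE).mono fun t ht => tendsto_div_boundary (hdB.entire S) hE.1 ht) hw
  have hS1' : MeasureTheory.Integrable
      (fun t : ℝ => conj (S t / E t * ((t : ℂ) - conj w)⁻¹)) := by
    simpa using! (Complex.conjCLE.toContinuousLinearMap.integrable_comp hS1)
  have hint : innerOf E Y G = ∫ t : ℝ, (E w * (T t / E t * ((t : ℂ) - conj w)⁻¹) -
      sharp E w * conj (S t / E t * ((t : ℂ) - conj w)⁻¹)) := by
    refine MeasureTheory.integral_congr_ae ((ae_ne_zero hE).mono fun t ht => ?_)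
    have htw' : (t : ℂ) - conj w ≠ 0 := by
      simpa using add_mul_I_sub_conj_ne_zero hw t le_rfl
    have htw : (t : ℂ) - w ≠ 0 := by
      intro h
      apply htw'
      have := congrArg conj h
      simpa using this
    have hTt : T t = (t - conj w) / (t - w) * Y t := hT t (sub_ne_zero.1 htw)
    have hSt : conj (S t) = Y t := by
      rw [hS]
      simp [sharp]
    have hGt : conj (G t) = (conj (E t) * E w - E t * sharp E w) / (t - w) := by
      rw [eq_div_iff htw, hG]
      have h := congrArg conj (sub_mul_kernelFun (E := E) w t)
      simp only [map_mul, map_sub, Complex.conj_conj, kernelNumerator, Complex.conj_ofReal] at h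
      rw [mul_comm, h]
      simp [sharp]
    have hcE : conj (E t) ≠ 0 := by simpa using ht
    have hsq : ((‖E t‖ ^ 2 : ℝ) : ℂ) = E t * conj (E t) := by
      rw [Complex.mul_conj, Complex.sq_norm]
    simp only [map_mul, map_div₀, map_inv₀, map_sub, Complex.conj_conj, Complex.conj_ofReal]
    rw [hsq, hGt, hSt, hTt]
    field_simp
  rw [hK.inner_eq, hint, MeasureTheory.integral_sub (hT1.const_mul _) (hS1'.const_mul _),
    MeasureTheory.integral_const_mul, MeasureTheory.integral_const_mul, hT2, integral_conj, hS2]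
  simp

theorem EqSpaceOf.exists_kernelFun (hK : EqSpaceOf K E) {w : ℂ} (hw : 0 < w.im) :
    ∃ G : K, (G : ℂ → ℂ) = kernelFun E w := by
  have := kernelFun_mem_spaceOf hK.hermiteBiehler hw
  rwa [← hK.range_eq] at this

/-- If X is orthogonal to G = K_w, then X - (X(w)/G(w)) G vanishes at w and is orthogonal to G too,
which forces X(w) = 0. So X vanishes on the upper half-plane, hence identically. -/
theorem EqSpaceOf.dense_span_kernelFun (hdB : IsDeBrangesSpace K) (hK : EqSpaceOf K E) :
    (Submodule.span ℂ {G : K | ∃ w : ℂ, 0 < w.im ∧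
      (G : ℂ → ℂ) = kernelFun E w}).topologicalClosure = ⊤ := by
  have := hdB.complete
  rw [Submodule.topologicalClosure_eq_top_iff, Submodule.eq_bot_iff]
  intro X hX
  have hzero : ∀ w : ℂ, 0 < w.im → X w = 0 := by
    intro w hw
    obtain ⟨G, hG⟩ := hK.exists_kernelFun hw
    have hGX : inner ℂ G X = 0 :=
      (Submodule.mem_orthogonal _ _).1 hX G (Submodule.subset_span ⟨w, hw, hG⟩)
    have hGw : G w ≠ 0 := by
      rw [hG]
      exact kernelFun_ne_zero hK.hermiteBiehler hw hw
    have hG0 : G ≠ 0 := by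
      rintro rfl
      simp at hGw
    have hY : (X - (X w / G w) • G) w = 0 := by
      simp [div_mul_cancel₀ _ hGw]
    have h := hK.inner_kernelFun_eq_zero hdB hw hG hY
    rw [inner_sub_right, hGX, inner_smul_right, zero_sub, neg_eq_zero, mul_eq_zero] at h
    rcases h with h | h
    · exact (div_eq_zero_iff.1 h).resolve_right hGw
    · exact absurd (inner_self_eq_zero.1 h) hG0
  apply RKHS.ext
  have han : AnalyticOnNhd ℂ X Set.univ := fun z _ => (hdB.entire X).analyticAt z
  have h0 : AnalyticOnNhd ℂ (0 : ℂ → ℂ) Set.univ := fun z _ => analyticAt_const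
  have := han.eq_of_eventuallyEq h0 (z₀ := Complex.I) (by
    filter_upwards [(isOpen_lt continuous_const Complex.continuous_im).mem_nhds
      (show (0 : ℝ) < Complex.I.im by simp)] with z hz
    exact hzero z hz)
  intro z
  rw [this]
  simp

end Density

/-! ### Functions with a majorant -/

section Majorant

variable {H : Type*} [NormedAddCommGroup H] [InnerProductSpace ℂ H] [RKHS ℂ H ℂ ℂ]

/-- The functions bounded by a nonnegative majorant form a linear subspace. -/
def majorizedSubmodule (H : Type*) [NormedAddCommGroup H] [InnerProductSpace ℂ H]
    [RKHS ℂ H ℂ ℂ] {D : Set ℂ} (m : D → ℝ) (hm : ∀ z, 0 ≤ m z) : Submodule ℂ H where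
  carrier := majorized H m
  zero_mem' := ⟨1, one_pos, fun z => by simp [sharp, hm z]⟩
  add_mem' := by
    rintro F G ⟨C, hC, hF⟩ ⟨C', hC', hG⟩
    refine ⟨C + C', by positivity, fun z => ⟨?_, ?_⟩⟩
    · rw [RKHS.coe_add, Pi.add_apply, add_mul]
      exact (norm_add_le _ _).trans (add_le_add (hF z).1 (hG z).1)
    · have e : sharp (F + G : H) z = sharp F z + sharp G z := by simp [sharp]
      rw [e, add_mul]
      exact (norm_add_le _ _).trans (add_le_add (hF z).2 (hG z).2)
  smul_mem' := by
    rintro c F ⟨C, hC, hF⟩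
    refine ⟨(‖c‖ + 1) * C, by positivity, fun z => ?_⟩
    have hle : ‖c‖ * (C * m z) ≤ (‖c‖ + 1) * C * m z := by
      have := mul_nonneg hC.le (hm z)
      nlinarith
    refine ⟨?_, ?_⟩
    · rw [RKHS.coe_smul, Pi.smul_apply, norm_smul]
      exact (mul_le_mul_of_nonneg_left (hF z).1 (norm_nonneg c)).trans hle
    · have e : sharp (c • F : H) z = conj c * sharp F z := by simp [sharp]
      rw [e, norm_mul, RCLike.norm_conj]
      exact (mul_le_mul_of_nonneg_left (hF z).2 (norm_nonneg c)).trans hle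

theorem majorant_nonneg (E : ℂ → ℂ) (z : ℂ) : 0 ≤ majorant E z := by
  unfold majorant
  positivity

theorem im_nonneg_of_mem_lineRay {β : ℝ} (hβ : β ∈ Set.Ioc (0 : ℝ) (1 / 2)) {z : ℂ}
    (hz : z ∈ lineRay β) : 0 ≤ z.im := by
  rcases hz with ⟨x, rfl⟩ | ⟨r, hr, rfl⟩
  · simp
  · have e : Complex.I * (Real.pi : ℂ) * (β : ℂ) = ((Real.pi * β : ℝ) : ℂ) * Complex.I := by
      push_cast
      ring
    have hs : 0 ≤ Real.sin (Real.pi * β) := by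
      have := Real.pi_pos
      have := hβ.1
      exact Real.sin_nonneg_of_nonneg_of_le_pi (by positivity) (by nlinarith [hβ.2])
    simp only [e, Complex.im_mul_ofReal, Complex.exp_ofReal_mul_I_im]
    exact mul_nonneg hs hr

/-- A space `H(E)` contained in `H` is contained in the closure of the functions bounded by the
majorant of `E`. -/
theorem subset_majorizedClosure {β : ℝ} (hβ : β ∈ Set.Ioc (0 : ℝ) (1 / 2)) {L : Submodule ℂ H}
    (hL : L ∈ Sub H) {E : ℂ → ℂ} (hE : EqSpaceOf L E) :
    (L : Set H) ⊆ majorizedClosure H ((lineRay β).domRestrict (majorant E)) := by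
  have hdB : IsDeBrangesSpace L := hL
  let M := majorizedSubmodule H ((lineRay β).domRestrict (majorant E))
    fun z => majorant_nonneg E z
  have hspan : Submodule.span ℂ {G : L | ∃ w : ℂ, 0 < w.im ∧
      (G : ℂ → ℂ) = kernelFun E w} ≤ M.comap L.subtype := by
    rw [Submodule.span_le]
    rintro G ⟨w, hw, hG⟩
    obtain ⟨C, hC, h⟩ := exists_norm_kernelFun_le hE.hermiteBiehler hw
    refine ⟨C, hC, fun z => ?_⟩
    have hz := im_nonneg_of_mem_lineRay hβ z.2
    have hG' : ((G : H) : ℂ → ℂ) = kernelFun E w := hG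
    show ‖(G : H) z‖ ≤ C * majorant E z ∧ ‖sharp (G : H) z‖ ≤ C * majorant E z
    rw [hG', majorant_eq hE.hermiteBiehler hz]
    exact h z hz
  intro F hF
  have hmem : (⟨F, hF⟩ : L) ∈ closure ((Submodule.span ℂ {G : L | ∃ w : ℂ, 0 < w.im ∧
      (G : ℂ → ℂ) = kernelFun E w} : Submodule ℂ L) : Set L) := by
    rw [← Submodule.topologicalClosure_coe, hE.dense_span_kernelFun hdB]
    trivial
  have himg := image_closure_subset_closure_image (f := (Subtype.val : L → H))
    continuous_subtype_val (Set.mem_image_of_mem _ hmem)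
  refine closure_mono ?_ himg
  rintro _ ⟨G, hG, rfl⟩
  exact hspan hG

end Majorant

end DeBranges

/-! ### Quotients of entire functions bounded on the real line -/

open Filter Topology in
/-- A quotient of entire functions whose denominator is zero-free in the upper half-plane and
which is bounded on the real line extends continuously to the closed upper half-plane. -/
theorem exists_continuousOn_quotient {F G : ℂ → ℂ} {C : ℝ} (hF : Differentiable ℂ F)
    (hG : Differentiable ℂ G) (hG0 : ∀ z : ℂ, 0 < z.im → G z ≠ 0)
    (hC : ∀ s : ℝ, ‖F s / G s‖ ≤ C) :
    ∃ f : ℂ → ℂ, DifferentiableOn ℂ f {z : ℂ | 0 < z.im} ∧ ContinuousOn f {z : ℂ | 0 ≤ z.im} ∧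
      (∀ s : ℝ, ‖f s‖ ≤ C) ∧ ∀ z : ℂ, 0 < z.im → f z = F z / G z := by
  let q : ℂ → ℂ := fun z => F z / G z
  -- The meromorphic normal form fills in the removable singularities at real zeros of G.
  have hq : MeromorphicOn q Set.univ := fun z _ =>
    (hF.analyticAt z).meromorphicAt.div (hG.analyticAt z).meromorphicAt
  let f := toMeromorphicNFOn q Set.univ
  have hup : ∀ z : ℂ, 0 < z.im → f =ᶠ[𝓝 z] q := by
    intro z hz
    have han : AnalyticAt ℂ q z := (hF.analyticAt z).div (hG.analyticAt z) (hG0 z hz)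
    have h := toMeromorphicNFOn_eq_toMeromorphicNFAt_on_nhds hq (Set.mem_univ z)
    rwa [toMeromorphicNFAt_eq_self.2 han.meromorphicNFAt] at h
  have hupan : ∀ z : ℂ, 0 < z.im → AnalyticAt ℂ f z := fun z hz =>
    ((hF.analyticAt z).div (hG.analyticAt z) (hG0 z hz)).congr (hup z hz).symm
  have hreal : ∀ t : ℝ, Tendsto (fun s : ℝ => (s : ℂ)) (𝓝[≠] t) (𝓝[≠] (t : ℂ)) := fun t =>
    tendsto_nhdsWithin_iff.2 ⟨(Complex.continuous_ofReal.tendsto t).mono_left nhdsWithin_le_nhds,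
      eventually_nhdsWithin_of_forall fun s hs h => hs (Complex.ofReal_injective h)⟩
  have hran : ∀ t : ℝ, AnalyticAt ℂ f t := by
    intro t
    have hNF : MeromorphicNFAt f t := meromorphicNFOn_toMeromorphicNFOn q _ (Set.mem_univ _)
    rw [← hNF.meromorphicOrderAt_nonneg_iff_analyticAt,
      meromorphicOrderAt_toMeromorphicNFOn hq (Set.mem_univ _)]
    by_contra hneg
    rw [not_le] at hneg
    have h := (tendsto_norm_cobounded_atTop.comp
      (tendsto_cobounded_of_meromorphicOrderAt_neg hneg)).comp (hreal t)
    obtain ⟨s, hs⟩ := (h.eventually_gt_atTop C).exists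
    exact absurd (hC s) (not_le_of_gt hs)
  refine ⟨f, fun z hz => (hupan z hz).differentiableAt.differentiableWithinAt, fun z hz => ?_,
    fun t => ?_, fun z hz => (hup z hz).eq_of_nhds⟩
  · rcases (show 0 ≤ z.im from hz).eq_or_lt with h | h
    · have : z = z.re := by apply Complex.ext <;> simp [← h]
      rw [this]
      exact (hran z.re).continuousAt.continuousWithinAt
    · exact (hupan z h).continuousAt.continuousWithinAt
  · have h1 : Tendsto (fun s : ℝ => ‖f s‖) (𝓝[≠] t) (𝓝 ‖f t‖) :=
      ((hran t).continuousAt.tendsto.mono_left nhdsWithin_le_nhds).norm.comp (hreal t)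
    refine le_of_tendsto h1 ?_
    filter_upwards [(hreal t).eventually
      (hq.toMeromorphicNFOn_eq_self_on_nhdsNE (Set.mem_univ (t : ℂ)))] with s hs
    show ‖toMeromorphicNFOn q Set.univ s‖ ≤ C
    rw [hs]
    exact hC s

/-! ### Growth of quotients in a de Branges space -/

namespace DeBranges

variable {H : Type*} [NormedAddCommGroup H] [InnerProductSpace ℂ H] [RKHS ℂ H ℂ ℂ]

/-- Growth of a quotient of two elements of a de Branges space with zero-free denominator. -/
theorem IsDeBrangesSpace.exists_norm_div_le_exp (hH : IsDeBrangesSpace H) (F G : H)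
    (hG0 : ∀ z : ℂ, 0 < z.im → G z ≠ 0) :
    ∃ A : ℝ, 0 ≤ A ∧ ∀ z : ℂ, 0 < z.im → 1 ≤ ‖z‖ →
      ‖F z / G z‖ ≤ Real.exp (A * ‖z‖ ^ 3 / z.im ^ 2) := by
  have := hH.complete
  set k : H := RKHS.kerFun H Complex.I (1 : ℂ) with hk
  have hkn : 0 < ‖k‖ := by
    rw [norm_pos_iff]
    intro h0
    have h1 : inner ℂ k G = G Complex.I := by simp [hk]
    rw [h0, inner_zero_left] at h1
    exact hG0 Complex.I (by simp) h1.symm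
  -- By the kernel estimate a zero of k in the half-plane would be a zero of every element, in
  -- particular of G.
  have hk0 : ∀ z : ℂ, 0 < z.im → k z ≠ 0 := by
    intro z hz h0
    have h := hH.sq_norm_apply_le G hz
    rw [← hk, h0, norm_zero] at h
    have := norm_pos_iff.2 (hG0 z hz)
    have : 0 < 4 * z.im * (‖k‖ ^ 2 * ‖G z‖ ^ 2) := by positivity
    nlinarith
  have hzI : ∀ z : ℂ, 0 < z.im → z + Complex.I ≠ 0 := fun z hz =>
    norm_pos_iff.1 (norm_add_I_pos hz.le)
  have hbound : ∀ (X : H) (z : ℂ), 0 < z.im →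
      ‖X z / ((z + Complex.I) * k z)‖ ≤ ‖X‖ / (2 * ‖k‖) / √z.im := by
    intro X z hz
    have h := hH.sq_norm_apply_le X hz
    rw [← hk] at h
    have h1 := norm_pos_iff.2 (hk0 z hz)
    have h2 := norm_add_I_pos hz.le
    have hs := Real.sqrt_pos.2 hz
    rw [norm_div, norm_mul, div_div, div_le_div_iff₀ (by positivity) (by positivity)]
    apply le_of_sq_le_sq _ (by positivity)
    calc (‖X z‖ * (2 * ‖k‖ * √z.im)) ^ 2 = 4 * (√z.im) ^ 2 * (‖k‖ ^ 2 * ‖X z‖ ^ 2) := by ring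
      _ = 4 * z.im * (‖k‖ ^ 2 * ‖X z‖ ^ 2) := by rw [Real.sq_sqrt hz.le]
      _ ≤ _ := h
      _ = _ := by ring
  obtain ⟨A, hA, h⟩ := exists_norm_inv_le_exp_of_ne_zero
    (v := fun z => G z / ((z + Complex.I) * k z)) (c := ‖G‖ / (2 * ‖k‖))
    ((hH.entire G).differentiableOn.div
      ((differentiableOn_id.add_const _).mul (hH.entire k).differentiableOn)
      fun z hz => mul_ne_zero (hzI z hz) (hk0 z hz))
    (fun z hz => div_ne_zero (hG0 z hz) (mul_ne_zero (hzI z hz) (hk0 z hz))) (hbound G)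
  refine ⟨‖F‖ / (2 * ‖k‖) + A, by positivity, fun z hz hz1 => ?_⟩
  have h1 := h z hz hz1
  have h2 := hbound F z hz
  have e : F z / G z = F z / ((z + Complex.I) * k z) * (G z / ((z + Complex.I) * k z))⁻¹ := by
    have := hzI z hz
    have := hk0 z hz
    have := hG0 z hz
    field_simp
  have hyz : z.im ≤ ‖z‖ := (le_abs_self _).trans (Complex.abs_im_le_norm z)
  have hs := Real.sqrt_pos.2 hz
  have hinv : (√z.im)⁻¹ ≤ ‖z‖ ^ 3 / z.im ^ 2 := by
    rw [le_div_iff₀ (by positivity), inv_mul_le_iff₀ hs]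
    have h3 : z.im ^ 2 = √z.im * (√z.im * z.im) := by
      rw [← mul_assoc, Real.mul_self_sqrt hz.le]; ring
    have h4 : √z.im ≤ ‖z‖ := by
      rw [Real.sqrt_le_left (by positivity)]
      nlinarith
    rw [h3]
    gcongr
    calc √z.im * z.im ≤ ‖z‖ * ‖z‖ := by gcongr
      _ ≤ ‖z‖ * ‖z‖ * ‖z‖ := le_mul_of_one_le_right (by positivity) hz1
      _ = ‖z‖ ^ 3 := by ring
  rw [e, norm_mul, norm_inv]
  calc _ ≤ Real.exp (‖F‖ / (2 * ‖k‖) * (‖z‖ ^ 3 / z.im ^ 2)) *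
        Real.exp (A * ‖z‖ ^ 3 / z.im ^ 2) := by
        gcongr
        refine h2.trans ?_
        rw [div_eq_mul_inv]
        calc ‖F‖ / (2 * ‖k‖) * (√z.im)⁻¹ ≤ ‖F‖ / (2 * ‖k‖) * (‖z‖ ^ 3 / z.im ^ 2) := by gcongr
          _ ≤ _ := by linarith [Real.add_one_le_exp (‖F‖ / (2 * ‖k‖) * (‖z‖ ^ 3 / z.im ^ 2))]
    _ = _ := by rw [← Real.exp_add]; congr 1; ring

end DeBranges

/-! ### From bounds on the line and the ray to membership in H(E) -/

namespace DeBranges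

section Bounded

variable {H : Type*} [NormedAddCommGroup H] [InnerProductSpace ℂ H] [RKHS ℂ H ℂ ℂ]

/-- An element of a de Branges space which is bounded by the majorant of `E` on the real line and
on a ray is bounded by it in the whole upper half-plane, provided the space contains a kernel
function of `H(E)`. -/
theorem IsDeBrangesSpace.exists_norm_le_of_majorized (hH : IsDeBrangesSpace H) {E : ℂ → ℂ}
    (hE : E ∈ HermiteBiehler) {G : H} (hG : (G : ℂ → ℂ) = kernelFun E Complex.I) {β : ℝ}
    (hβ : β ∈ Set.Ioc (0 : ℝ) (1 / 2)) {F : H} {C : ℝ} (hC : 0 ≤ C)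
    (hF : ∀ z ∈ lineRay β, ‖F z‖ ≤ C * majorant E z) :
    ∃ C' : ℝ, ∀ z : ℂ, 0 < z.im → ‖F z‖ ≤ C' * (‖E z‖ / ‖z + Complex.I‖) := by
  have hI : 0 < Complex.I.im := by simp
  obtain ⟨c, hc, hlow⟩ := exists_le_norm_kernelFun hE hI
  obtain ⟨c', hc', hup⟩ := exists_norm_kernelFun_le hE hI
  rw [← hG] at hlow hup
  have hG0 : ∀ z : ℂ, 0 < z.im → G z ≠ 0 := fun z hz => by
    rw [hG]
    exact kernelFun_ne_zero hE hI hz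
  have hD : ∀ z ∈ lineRay β, ‖F z / G z‖ ≤ C * c := by
    intro z hz
    have hz0 := im_nonneg_of_mem_lineRay hβ hz
    rw [norm_div]
    -- G may vanish at a real point; the quotient is then 0 by convention and the bound still holds.
    refine div_le_of_le_mul₀ (norm_nonneg _) (by positivity) ?_
    refine (hF z hz).trans ?_
    rw [majorant_eq hE hz0, mul_assoc]
    gcongr
    exact hlow z hz0
  obtain ⟨f, hfd, hfc, hfr, hfq⟩ := exists_continuousOn_quotient (hH.entire F) (hH.entire G) hG0
    (C := C * c) fun s => hD s (Or.inl ⟨s, rfl⟩)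
  obtain ⟨A, hA, hgrowth⟩ := hH.exists_norm_div_le_exp F G hG0
  obtain ⟨K, B, hKB⟩ := exists_norm_le_exp_of_bounded_on_real hA (le_max_right (C * c) 1) hfd hfc
    (fun s => (hfr s).trans (le_max_left _ _)) fun z hz hz1 => by
      rw [hfq z hz]
      exact hgrowth z hz hz1
  have hray : ∀ r : ℝ, 0 ≤ r →
      ‖f (Complex.exp (Complex.I * Real.pi * β) * r)‖ ≤ C * c := by
    intro r hr
    have hmem : Complex.exp (Complex.I * Real.pi * β) * r ∈ lineRay β := Or.inr ⟨r, hr, rfl⟩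
    rcases hr.eq_or_lt with rfl | hr
    · simpa using hfr 0
    have him : 0 < (Complex.exp (Complex.I * Real.pi * β) * r).im := by
      have e : Complex.I * (Real.pi : ℂ) * (β : ℂ) = ((Real.pi * β : ℝ) : ℂ) * Complex.I := by
        push_cast
        ring
      rw [e, Complex.im_mul_ofReal, Complex.exp_ofReal_mul_I_im]
      have hpi := Real.pi_pos
      have hβ0 := hβ.1
      exact mul_pos (Real.sin_pos_of_pos_of_lt_pi (by positivity) (by nlinarith [hβ.2])) hr
    rw [hfq _ him]
    exact hD _ hmem
  refine ⟨C * c * c', fun z hz => ?_⟩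
  have hfz := norm_le_of_bounded_on_real_and_ray hβ.1 (by linarith [hβ.2]) hfd hfc hfr hray hKB hz
  rw [hfq z hz, norm_div, div_le_iff₀ (norm_pos_iff.2 (hG0 z hz))] at hfz
  refine hfz.trans ?_
  rw [mul_assoc (C * c)]
  gcongr
  exact (hup z hz.le).1

end Bounded

/-- The closure of the functions bounded by the majorant of `E` on the real line and a ray is
contained in `H(E)`. -/
theorem majorizedClosure_subset {H : Type*} [NormedAddCommGroup H] [InnerProductSpace ℂ H]
    [RKHS ℂ H ℂ ℂ] (hH : IsDeBrangesSpace H) {β : ℝ} (hβ : β ∈ Set.Ioc (0 : ℝ) (1 / 2))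
    {L : Submodule ℂ H} (hL : L ∈ Sub H) {E : ℂ → ℂ} (hE : EqSpaceOf L E) :
    majorizedClosure H ((lineRay β).domRestrict (majorant E)) ⊆ (L : Set H) := by
  have hdB : IsDeBrangesSpace L := hL
  have hcomplete : IsComplete (L : Set H) :=
    completeSpace_coe_iff_isComplete.1 hdB.complete
  refine closure_minimal ?_ hcomplete.isClosed
  rintro F ⟨C, hC, hF⟩
  obtain ⟨G, hG⟩ := hE.exists_kernelFun (w := Complex.I) (by simp)
  have hG' : ((G : H) : ℂ → ℂ) = kernelFun E Complex.I := hG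
  -- The growth estimate applies to elements of H only, so F^# is first realized as such an element.
  obtain ⟨F', hF', -⟩ := hH.sharp_mem F
  obtain ⟨C₁, h₁⟩ := hH.exists_norm_le_of_majorized hE.hermiteBiehler hG' hβ hC.le
    (F := F) fun z hz => (hF ⟨z, hz⟩).1
  obtain ⟨C₂, h₂⟩ := hH.exists_norm_le_of_majorized hE.hermiteBiehler hG' hβ hC.le
    (F := F') fun z hz => by
      rw [hF']
      exact (hF ⟨z, hz⟩).2
  rw [hF'] at h₂
  have hmem : (F : ℂ → ℂ) ∈ spaceOf E := by
    refine mem_spaceOf_of_norm_le hE.hermiteBiehler (C := max C₁ C₂) (hH.entire F)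
      (fun z hz => (h₁ z hz).trans ?_) fun z hz => (h₂ z hz).trans ?_
    · gcongr
      exact le_max_left _ _
    · gcongr
      exact le_max_right _ _
  rw [← hE.range_eq] at hmem
  obtain ⟨X, hX⟩ := hmem
  have : (X : H) = F := RKHS.ext fun z => congrFun hX z
  rw [← this]
  exact X.2

end DeBranges

theorem propositionA54 (β : ℝ) (hβ : β ∈ Set.Ioc (0 : ℝ) (1 / 2))
    (H : Type*) [NormedAddCommGroup H] [InnerProductSpace ℂ H] [RKHS ℂ H ℂ ℂ]
    (hH : DeBranges.IsDeBrangesSpace H)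
    (L : Submodule ℂ H) (hL : L ∈ DeBranges.Sub H)
    (E₁ : ℂ → ℂ) (hE₁ : DeBranges.EqSpaceOf L E₁) :
    (L : Set H) =
      DeBranges.majorizedClosure H
        ((DeBranges.lineRay β).domRestrict (DeBranges.majorant E₁)) :=
  Set.Subset.antisymm (DeBranges.subset_majorizedClosure hβ hL hE₁)
    (DeBranges.majorizedClosure_subset hH hβ hL hE₁)
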